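/- Let $k$ be a nonzero commutative Noetherian ring, $n\ge 0$, and let $q_{i,j}\in k^{*}$ ($1\le i,j\le n$) satisfy $q_{i,i}=1$ and $q_{j,i}=q_{i,j}^{-1}$. Let $R=k_{\mathfrak q}[x_1,\dots,x_n]$ be the skew polynomial ring, i.e. the $k$-algebra generated by $x_1,\dots,x_n$ with relations $x_ix_j=q_{i,j}x_jx_i$; its monomials are $\mathbf x^{\mathbf a}=x_1^{a_1}\cdots x_n^{a_n}$, and $\mathbf x^{\mathbf a}*\mathbf x^{\mathbf b}=\mathbf x^{\mathbf a+\mathbf b}$. For a monomial $w=\mathbf x^{\mathbf a}$ put $\deg(w)=a_1+\cdots+a_n$ (so $\deg x_i=1$) and $\max(w)=\max\{i\mid a_i>0\}$, with the convention $\max(1)=1$. A two-sided ideal $I$ of $R$ generated by monomials is called stable if for every monomial $w\in I$ and every index $i<\max(w)$ the monomial $(x_i*w)/x_{\max(w)}$ lies in $I$. Let $G(I)$ be the (finite) set of monomials of $I$ that are minimal with respect to divisibility, i.e. the unique minimal system of monomial generators of $I$. Let $I$ be a stable ideal of $R$, regarded as a right $R$-module. Then: 1. $I$ has a minimal free resolution,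 that is, an exact sequence of right $R$-modules $\cdots\to R^{b_1}\xrightarrow{d_1} R^{b_0}\to I\to 0$ with all $b_q$ finite and $d_q(R^{b_q})\subseteq R^{b_{q-1}}(x_1,\dots,x_n)$ for all $q\ge1$; and in every such resolution the ranks $b_q$ are the same, so that the Betti numbers $\beta_q(I)=b_q$ are well defined, and are given for all $q\ge 0$ by $$\beta_q(I)=\sum_{u\in G(I)}\binom{\max(u)-1}{q}.$$ 2. The projective dimension of $I$ is $$\mathrm{pd}_R I=\max\{\max(u)-1\mid u\in G(I)\},$$ where both sides are read as $-\infty$ if $I=0$. 3. For every $j\ge 0$ let $I_j$ be the intersection of $I$ with the $k$-span of the monomials of degree $j$. Then $I_j$ is a free $k$-module of finite rank, and the Poincaré series $\mathrm P_I^R(t)=\sum_{j\ge0}\mathrm{rank}_k(I_j)\,t^j$ of $I$ is $$\mathrm P_I^R(t)=\sum_{u\in G(I)}\frac{t^{\deg(u)}}{(1-t)^{\,n-\max(u)+1}}.$$ -/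

import Mathlib

namespace SkewEK

universe u

/-- The commutation parameters of a skew polynomial ring: `q i i = 1` and `q j i = (q i j)⁻¹`. -/
def IsSkewParameter {k : Type u} [CommRing k] {n : ℕ} (q : Fin n → Fin n → kˣ) : Prop :=
  (∀ i, q i i = 1) ∧ ∀ i j, q j i = (q i j)⁻¹

/-- The defining relations `x_i x_j = q_{i,j} x_j x_i` on the free `k`-algebra. -/
inductive SkewRel {k : Type u} [CommRing k] {n : ℕ} (q : Fin n → Fin n → kˣ) :
    FreeAlgebra k (Fin n) → FreeAlgebra k (Fin n) → Prop
  | comm (i j : Fin n) :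
      SkewRel q (FreeAlgebra.ι k i * FreeAlgebra.ι k j)
        (((q i j : kˣ) : k) • (FreeAlgebra.ι k j * FreeAlgebra.ι k i))

/-- The skew polynomial ring `k_q[x_1, …, x_n]`: the `k`-algebra generated by `x_1, …, x_n`
subject to `x_i x_j = q_{i,j} x_j x_i`. The variable `x_{i+1}` is indexed by `i : Fin n`. -/
def SkewPoly {k : Type u} [CommRing k] {n : ℕ} (q : Fin n → Fin n → kˣ) : Type u :=
  RingQuot (SkewRel q)

section

variable {k : Type u} [CommRing k] {n : ℕ} (q : Fin n → Fin n → kˣ)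

noncomputable instance instRingSkewPoly : Ring (SkewPoly q) :=
  inferInstanceAs (Ring (RingQuot (SkewRel q)))

noncomputable instance instAlgebraSkewPoly : Algebra k (SkewPoly q) :=
  inferInstanceAs (Algebra k (RingQuot (SkewRel q)))

/-- The variable `x_{i+1}`. -/
noncomputable def var (i : Fin n) : SkewPoly q :=
  RingQuot.mkAlgHom k (SkewRel q) (FreeAlgebra.ι k i)

/-- The monomial `x^a = x_1^{a_1} ⋯ x_n^{a_n}` (product in this order). Thus the monomials are
indexed by exponent vectors, `x^a * x^b` (the monoid operation) is `x^{a+b}`, and `x^b` divides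
`x^a` if and only if `b ≤ a`. -/
noncomputable def monomial (a : Fin n → ℕ) : SkewPoly q :=
  (List.ofFn fun i => var q i ^ a i).prod

end

/-- `max(x^a)`, the largest (one-based) index of a variable occurring in `x^a`,
with the convention `max(1) = 1`. -/
def maxIdx {n : ℕ} (a : Fin n → ℕ) : ℕ :=
  max 1 ((Finset.univ.filter fun i => 0 < a i).sup fun i => (i : ℕ) + 1)

/-- The total degree of `x^a`. -/
def deg {n : ℕ} (a : Fin n → ℕ) : ℕ := ∑ i, a i

section

variable {k : Type u} [CommRing k] {n : ℕ} {q : Fin n → Fin n → kˣ}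

/-- A (two-sided) ideal generated by monomials. -/
def IsMonomialIdeal (I : TwoSidedIdeal (SkewPoly q)) : Prop :=
  ∃ S : Set (Fin n → ℕ), I = TwoSidedIdeal.span (monomial q '' S)

/-- A monomial ideal `I` is stable if for each monomial `w ∈ I` and each index `i < max(w)`
the monomial `x_i * w / x_{max(w)}` belongs to `I`. Here `m` is the variable of index `max(w)`. -/
def IsStable (I : TwoSidedIdeal (SkewPoly q)) : Prop :=
  IsMonomialIdeal I ∧
    ∀ w : Fin n → ℕ, monomial q w ∈ I → ∀ i m : Fin n, i < m → (m : ℕ) + 1 = maxIdx w →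
      monomial q (w + Pi.single i 1 - Pi.single m 1) ∈ I

/-- (Exponents of) the monomials of `I` that are minimal with respect to divisibility among the
monomials of `I`. -/
def minimalMonomials (I : TwoSidedIdeal (SkewPoly q)) : Set (Fin n → ℕ) :=
  {a | Minimal (fun b => monomial q b ∈ I) a}

theorem finite_minimalMonomials (I : TwoSidedIdeal (SkewPoly q)) :
    (minimalMonomials I).Finite :=
  (setOfPred_minimal_antichain _).finite_of_partiallyWellOrderedOn
    ((Set.isPWO_of_wellQuasiOrderedLE _))

/-- The canonical generator system `G(I)`: the minimal monomials of `I`. -/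
noncomputable def canonicalGenerators (I : TwoSidedIdeal (SkewPoly q)) : Finset (Fin n → ℕ) :=
  (finite_minimalMonomials I).toFinset

variable (q) in
/-- The ideal `(x_1, …, x_n)`. -/
noncomputable def irrelevantIdeal : TwoSidedIdeal (SkewPoly q) :=
  TwoSidedIdeal.span (Set.range (var q))

/-- A minimal free resolution
`⋯ → R^{rank 2} → R^{rank 1} → R^{rank 0} → I → 0`
of `I` by right `R`-modules: an exact sequence of right `R`-linear maps such that
`d(R^{rank (i+1)}) ⊆ R^{rank i} (x_1, …, x_n)` for all `i`, that is, all coordinates of the values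
of `d` lie in `(x_1, …, x_n)`. Right `R`-modules are modules over `Rᵐᵒᵖ`. -/
structure MinimalFreeResolution (I : TwoSidedIdeal (SkewPoly q)) where
  rank : ℕ → ℕ
  d : ∀ i : ℕ, (Fin (rank (i + 1)) → SkewPoly q) →ₗ[(SkewPoly q)ᵐᵒᵖ] (Fin (rank i) → SkewPoly q)
  augmentation : (Fin (rank 0) → SkewPoly q) →ₗ[(SkewPoly q)ᵐᵒᵖ] I
  augmentation_surjective : Function.Surjective augmentation
  exact_zero : Function.Exact (d 0) augmentation
  exact_succ : ∀ i, Function.Exact (d (i + 1)) (d i)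
  minimal : ∀ i v j, d i v j ∈ irrelevantIdeal q

/-- `pd_R I`, the projective dimension of `I` as a right `R`-module (it is `⊥` for `I = 0`). -/
noncomputable def projDim (I : TwoSidedIdeal (SkewPoly q)) : WithBot ℕ∞ :=
  CategoryTheory.projectiveDimension (ModuleCat.of (SkewPoly q)ᵐᵒᵖ I)

variable (q) in
/-- The component `R_j` of degree `j` of `R`, graded by `deg x_i = 1`. -/
noncomputable def homogeneousPart (j : ℕ) : Submodule k (SkewPoly q) :=
  Submodule.span k (monomial q '' {a | deg a = j})

/-- The component `I_j = I ∩ R_j` of degree `j` of `I`. -/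
noncomputable def idealPart (I : TwoSidedIdeal (SkewPoly q)) (j : ℕ) : Submodule k (SkewPoly q) :=
  (TwoSidedIdeal.asIdeal I).restrictScalars k ⊓ homogeneousPart q j

/-- The Poincaré series `P_I(t) = ∑_j rank_k(I_j) t^j`. -/
noncomputable def poincareSeries (I : TwoSidedIdeal (SkewPoly q)) : PowerSeries ℚ :=
  PowerSeries.mk fun j => (Module.finrank k (idealPart I j) : ℚ)

end

end SkewEK

namespace SkewEK

/-! ### The monomial basis and monomial ideals. -/

section Ring

variable {k : Type*} [CommRing k] {n : ℕ} {q : Fin n → Fin n → kˣ}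

/-! The monomials form a `k`-basis (`linearIndependent_monomial`) and multiply like commutative
monomials up to units, so monomial ideals are governed by exponent vectors. Stability enters through
one fact: each monomial of `I` is uniquely `u * y` with `u ∈ G(I)` and all variables of `y` of index
at least `max(u)` (`IsStable.exists_decomposition`, with uniqueness from `toLex_le_of_le`). Counting
the cofactors `y` gives the Poincaré series.

The same fact shows that `G(I)`, listed in decreasing lexicographic order, has linear quotients: the
elements multiplying `u` into the ideal of the earlier generators form `(x_1, …, x_{max(u)-1})`. The
resolution is built from this without explicit differentials. Take the last nonzero coordinate of a
vector as its leading one. The first syzygy module then has leading ideals generated by initial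
segments of the variables (`HasVariableLeadingIdeals`). This property passes to the next syzygy
module, where a segment of length `m` is replaced by segments of lengths `0, …, m-1`, as in a Koszul
complex (`HasVariableLeadingIdeals.exists_next`). The hockey-stick identity turns this into the
Betti numbers.

An arbitrary minimal resolution need not be graded and `k` need not be a field, so uniqueness of the
ranks comes from Schanuel's lemma, with reduction to constant terms (`card_le_of_minimal_covers`).
For the projective dimension, dimension shifting shows that it is less than `i` exactly when the
`i`-th rank vanishes; a projective cokernel would otherwise put `1` into `(x_1, …, x_n)`. -/

theorem var_mul_var (i j : Fin n) :
    var q i * var q j = ((q i j : kˣ) : k) • (var q j * var q i) := by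
  have h := RingQuot.mkAlgHom_rel k (SkewRel.comm (q := q) i j)
  rw [map_mul, map_smul, map_mul] at h
  exact h

/-- The product of the variables with the given indices, in the given order. -/
noncomputable def word (q : Fin n → Fin n → kˣ) (w : List (Fin n)) : SkewPoly q :=
  (w.map (var q)).prod

theorem word_append (v w : List (Fin n)) : word q (v ++ w) = word q v * word q w := by
  simp [word]

/-- Each adjacent transposition costs a unit. The value of the unit plays no role later, so only its
existence is recorded. -/
theorem word_perm {v w : List (Fin n)} (h : v.Perm w) :
    ∃ c : kˣ, word q v = (c : k) • word q w := by
  induction h with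
  | nil => exact ⟨1, by simp⟩
  | cons x _ ih =>
    obtain ⟨c, hc⟩ := ih
    refine ⟨c, ?_⟩
    simp only [word, List.map_cons, List.prod_cons] at hc ⊢
    rw [hc, mul_smul_comm]
  | swap x y l =>
    refine ⟨q y x, ?_⟩
    simp only [word, List.map_cons, List.prod_cons]
    rw [← mul_assoc, var_mul_var, smul_mul_assoc, mul_assoc]
  | trans _ _ ih₁ ih₂ =>
    obtain ⟨c, hc⟩ := ih₁
    obtain ⟨d, hd⟩ := ih₂
    exact ⟨c * d, by rw [hc, hd, smul_smul, Units.val_mul]⟩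

/-- The word `x_1 ⋯ x_1 x_2 ⋯ x_2 ⋯` with exponents `a`. -/
def sortedWord (a : Fin n → ℕ) : List (Fin n) :=
  (List.ofFn fun i => List.replicate (a i) i).flatten

theorem word_sortedWord (a : Fin n → ℕ) : word q (sortedWord a) = monomial q a := by
  have h : (List.map (var q) ∘ fun i : Fin n => List.replicate (a i) i) =
      fun i => List.replicate (a i) (var q i) := by
    funext i; simp
  rw [word, sortedWord, List.map_flatten, List.prod_flatten, List.map_ofFn, List.map_ofFn, h,
    monomial]
  congr 2
  funext i
  simp

theorem count_sortedWord (a : Fin n → ℕ) (i : Fin n) : (sortedWord a).count i = a i := by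
  rw [sortedWord, List.count_flatten, List.map_ofFn, List.sum_ofFn]
  simp [List.count_replicate]

theorem exists_monomial_mul_monomial (q : Fin n → Fin n → kˣ) (a b : Fin n → ℕ) :
    ∃ c : kˣ, monomial q a * monomial q b = (c : k) • monomial q (a + b) := by
  rw [← word_sortedWord a, ← word_sortedWord b, ← word_append, ← word_sortedWord (a + b)]
  exact word_perm (List.perm_iff_count.2 fun i => by
    rw [List.count_append, count_sortedWord, count_sortedWord, count_sortedWord, Pi.add_apply])

/-- The unit `c` with `x^a x^b = c x^{a+b}`. -/
noncomputable def cocycle (q : Fin n → Fin n → kˣ) (a b : Fin n → ℕ) : kˣ :=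
  (exists_monomial_mul_monomial q a b).choose

theorem monomial_mul_monomial (a b : Fin n → ℕ) :
    monomial q a * monomial q b = (cocycle q a b : k) • monomial q (a + b) :=
  (exists_monomial_mul_monomial q a b).choose_spec

theorem monomial_add (a b : Fin n → ℕ) :
    monomial q (a + b) = (((cocycle q a b)⁻¹ : kˣ) : k) • (monomial q a * monomial q b) := by
  rw [monomial_mul_monomial, smul_smul, Units.inv_mul, one_smul]

@[simp] theorem monomial_zero : monomial q (0 : Fin n → ℕ) = 1 := by
  rw [← word_sortedWord]
  simp [word, sortedWord]

theorem monomial_single (i : Fin n) : monomial q (Pi.single i 1) = var q i := by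
  rw [← word_sortedWord]
  have h : (sortedWord (Pi.single i 1)).Perm [i] := by
    refine List.perm_iff_count.2 fun j => ?_
    rw [count_sortedWord, List.count_singleton]
    by_cases hj : j = i
    · subst hj; simp
    · simp [hj, Ne.symm hj]
  rw [List.perm_singleton.1 h]
  simp [word]

theorem span_monomial : Submodule.span k (Set.range (monomial q)) = ⊤ := by
  have hmul : ∀ x ∈ Submodule.span k (Set.range (monomial q)),
      ∀ y ∈ Submodule.span k (Set.range (monomial q)),
        x * y ∈ Submodule.span k (Set.range (monomial q)) := by
    intro x hx y hy
    have h := Submodule.mul_mem_mul hx hy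
    rw [Submodule.span_mul_span] at h
    refine Submodule.span_le.2 ?_ h
    rintro _ ⟨_, ⟨a, rfl⟩, _, ⟨b, rfl⟩, rfl⟩
    simp only [monomial_mul_monomial]
    exact Submodule.smul_mem _ _ (Submodule.subset_span ⟨_, rfl⟩)
  have hone : (1 : SkewPoly q) ∈ Submodule.span k (Set.range (monomial q)) :=
    Submodule.subset_span ⟨0, monomial_zero⟩
  rw [eq_top_iff]
  rintro x -
  obtain ⟨y, rfl⟩ := RingQuot.mkAlgHom_surjective k (SkewRel q) x
  induction y using FreeAlgebra.induction with
  | grade0 r =>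
    rw [AlgHom.commutes, Algebra.algebraMap_eq_smul_one]
    exact Submodule.smul_mem _ _ hone
  | grade1 i => exact Submodule.subset_span ⟨Pi.single i 1, monomial_single i⟩
  | mul a b ha hb => rw [map_mul]; exact hmul _ ha _ hb
  | add a b ha hb => rw [map_add]; exact Submodule.add_mem _ ha hb

/-- The unit `c` with `x_i x^a = c x^{a+e_i}`. -/
def actionCoeff (q : Fin n → Fin n → kˣ) (i : Fin n) (a : Fin n → ℕ) : kˣ :=
  ∏ j with j < i, q i j ^ a j

theorem actionCoeff_add_single (i j : Fin n) (a : Fin n → ℕ) :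
    actionCoeff q i (a + Pi.single j 1) =
      actionCoeff q i a * if j < i then q i j else 1 := by
  simp only [actionCoeff, Pi.add_apply, pow_add, Finset.prod_mul_distrib]
  congr 1
  split_ifs with h
  · rw [Finset.prod_eq_single_of_mem j (by simpa using h)]
    · simp
    · intro l _ hl; simp [hl]
  · refine Finset.prod_eq_one fun l hl => ?_
    have : l ≠ j := by rintro rfl; exact h (by simpa using hl)
    simp [this]

/-- Left multiplication by `x_i` on the free module with basis the monomials. -/
noncomputable def action (q : Fin n → Fin n → kˣ) (i : Fin n) :
    Module.End k ((Fin n → ℕ) →₀ k) :=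
  Finsupp.linearCombination k fun a =>
    Finsupp.single (a + Pi.single i 1) ((actionCoeff q i a : kˣ) : k)

theorem action_single (i : Fin n) (a : Fin n → ℕ) (c : k) :
    action q i (Finsupp.single a c) =
      Finsupp.single (a + Pi.single i 1) (c * (actionCoeff q i a : kˣ)) := by
  rw [action, Finsupp.linearCombination_single, Finsupp.smul_single, smul_eq_mul]

/-- This makes the free module on the monomials a representation. It is the step that uses `q i i =
1` and `q j i = (q i j)⁻¹`; without them monomials may become dependent. -/
theorem action_mul_action (hq : IsSkewParameter q) (i j : Fin n) :
    action q i * action q j = ((q i j : kˣ) : k) • (action q j * action q i) := by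
  refine Finsupp.lhom_ext fun a c => ?_
  simp only [Module.End.mul_apply, LinearMap.smul_apply, action_single, Finsupp.smul_single,
    actionCoeff_add_single, smul_eq_mul]
  rw [add_right_comm]
  congr 1
  rcases lt_trichotomy i j with h | rfl | h
  · rw [if_neg h.not_gt, if_pos h, hq.2 i j]
    simp only [mul_one, Units.val_mul]
    linear_combination (-(c * (actionCoeff q j a : k) * (actionCoeff q i a : k))) *
      (q i j).mul_inv
  · simp [hq.1]
  · rw [if_pos h, if_neg h.not_gt]
    simp only [mul_one, Units.val_mul]
    ring

/-- The representation of the skew polynomial ring on the free module with basis the monomials. -/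
noncomputable def representation (hq : IsSkewParameter q) :
    SkewPoly q →ₐ[k] Module.End k ((Fin n → ℕ) →₀ k) :=
  RingQuot.liftAlgHom k ⟨FreeAlgebra.lift k (action q), by
    rintro _ _ ⟨i, j⟩
    simp only [map_mul, map_smul, FreeAlgebra.lift_ι_apply]
    exact action_mul_action hq i j⟩

theorem representation_var (hq : IsSkewParameter q) (i : Fin n) :
    representation hq (var q i) = action q i := by
  rw [representation, var]
  erw [RingQuot.liftAlgHom_mkAlgHom_apply]
  rw [FreeAlgebra.lift_ι_apply]

theorem representation_word (hq : IsSkewParameter q) (w : List (Fin n)) :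
    ∃ c : kˣ, representation hq (word q w) (Finsupp.single 0 1) =
      Finsupp.single (fun i => w.count i) (c : k) := by
  induction w with
  | nil =>
    refine ⟨1, ?_⟩
    simp only [word, List.map_nil, List.prod_nil, map_one, Module.End.one_apply, Units.val_one,
      List.count_nil]
    rfl
  | cons j w ih =>
    obtain ⟨c, hc⟩ := ih
    refine ⟨c * actionCoeff q j (fun i => w.count i), ?_⟩
    rw [word, List.map_cons, List.prod_cons, map_mul, Module.End.mul_apply,
      representation_var, ← word, hc, action_single, Units.val_mul]
    congr 1
    funext i
    by_cases h : j = i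
    · subst h; simp
    · simp [h, Ne.symm h]

/-- Applied to the basis vector at exponent `0`, each `x^a` gives a unit multiple of the basis
vector at `a`, and these images are independent. -/
theorem linearIndependent_monomial (hq : IsSkewParameter q) :
    LinearIndependent k (monomial q) := by
  have h : ∀ a : Fin n → ℕ, ∃ c : kˣ, representation hq (monomial q a) (Finsupp.single 0 1) =
      Finsupp.single a (c : k) := by
    intro a
    obtain ⟨c, hc⟩ := representation_word hq (sortedWord a)
    refine ⟨c, ?_⟩
    rw [← word_sortedWord, hc]
    simp only [count_sortedWord]
  choose c hc using h
  refine LinearIndependent.of_comp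
    ((LinearMap.applyₗ (Finsupp.single 0 1)).comp (representation hq).toLinearMap) ?_
  have := (Finsupp.basisSingleOne (R := k) (ι := Fin n → ℕ)).linearIndependent.units_smul c
  convert this using 1
  funext a
  simp [hc, Units.smul_def]

/-- The monomials form a basis of the skew polynomial ring. -/
noncomputable def monomialBasis (hq : IsSkewParameter q) :
    Module.Basis (Fin n → ℕ) k (SkewPoly q) :=
  Module.Basis.mk (linearIndependent_monomial hq) span_monomial.ge

@[simp] theorem monomialBasis_apply (hq : IsSkewParameter q) (a : Fin n → ℕ) :
    monomialBasis hq a = monomial q a := by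
  simp [monomialBasis]

/-- The coefficient of `x^a`. -/
noncomputable def coeff (hq : IsSkewParameter q) (a : Fin n → ℕ) : SkewPoly q →ₗ[k] k :=
  (monomialBasis hq).coord a

theorem coeff_monomial (hq : IsSkewParameter q) (a b : Fin n → ℕ) :
    coeff hq a (monomial q b) = if b = a then 1 else 0 := by
  rw [coeff, Module.Basis.coord_apply, ← monomialBasis_apply hq, Module.Basis.repr_self,
    Finsupp.single_apply]

/-- Induction on the monomials occurring in an element. -/
theorem induction_monomial {p : SkewPoly q → Prop} (r : SkewPoly q) (zero : p 0)
    (add : ∀ x y, p x → p y → p (x + y)) (smul : ∀ (c : k) (a : Fin n → ℕ),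
      p (c • monomial q a)) : p r := by
  have hr : r ∈ Submodule.span k (Set.range (monomial q)) := by rw [span_monomial]; trivial
  induction hr using Submodule.closure_induction with
  | zero => exact zero
  | add x y _ _ hx hy => exact add x y hx hy
  | smul_mem c x hx => obtain ⟨a, rfl⟩ := hx; exact smul c a

/-- Translation by `a` is injective on exponents, so left multiplication by `x^a` merges no terms
and only rescales coefficients by units. -/
theorem coeff_add_monomial_mul (hq : IsSkewParameter q) (a b : Fin n → ℕ) (r : SkewPoly q) :
    coeff hq (a + b) (monomial q a * r) = cocycle q a b * coeff hq b r := by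
  induction r using induction_monomial with
  | zero => simp
  | add x y hx hy => rw [mul_add, map_add, hx, hy, map_add, mul_add]
  | smul c d =>
    rw [mul_smul_comm, monomial_mul_monomial, map_smul, map_smul, map_smul, coeff_monomial,
      coeff_monomial]
    by_cases h : d = b
    · subst h; simp [mul_comm]
    · simp [h]

theorem coeff_monomial_mul_of_not_le (hq : IsSkewParameter q) {a c : Fin n → ℕ} (h : ¬a ≤ c)
    (r : SkewPoly q) : coeff hq c (monomial q a * r) = 0 := by
  induction r using induction_monomial with
  | zero => simp
  | add x y hx hy => rw [mul_add, map_add, hx, hy, add_zero]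
  | smul e d =>
    rw [mul_smul_comm, monomial_mul_monomial, map_smul, map_smul, coeff_monomial, if_neg]
    · simp
    · rintro rfl; exact h le_self_add

/-- The elements all of whose monomials have exponents in `U`. -/
noncomputable def supported (q : Fin n → Fin n → kˣ) (U : Set (Fin n → ℕ)) :
    Submodule k (SkewPoly q) :=
  Submodule.span k (monomial q '' U)

theorem mem_supported (hq : IsSkewParameter q) {U : Set (Fin n → ℕ)} {r : SkewPoly q} :
    r ∈ supported q U ↔ ∀ a, coeff hq a r ≠ 0 → a ∈ U := by
  have h : monomial q '' U = monomialBasis hq '' U := by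
    ext; simp
  rw [supported, h, Module.Basis.mem_span_image]
  constructor
  · intro h a ha
    exact h (by simpa [coeff] using ha)
  · intro h a ha
    exact h a (by simpa [coeff] using ha)

theorem monomial_mem_supported {U : Set (Fin n → ℕ)} {a : Fin n → ℕ} (h : a ∈ U) :
    monomial q a ∈ supported q U :=
  Submodule.subset_span ⟨a, h, rfl⟩

theorem monomial_mem_supported_iff [Nontrivial k] (hq : IsSkewParameter q)
    {U : Set (Fin n → ℕ)} {a : Fin n → ℕ} : monomial q a ∈ supported q U ↔ a ∈ U := by
  refine ⟨fun h => (mem_supported hq).1 h a ?_, monomial_mem_supported⟩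
  simp [coeff_monomial]

theorem mul_mem_supported {U V W : Set (Fin n → ℕ)} (h : ∀ a ∈ U, ∀ b ∈ V, a + b ∈ W)
    {r s : SkewPoly q} (hr : r ∈ supported q U) (hs : s ∈ supported q V) :
    r * s ∈ supported q W := by
  have h' := Submodule.mul_mem_mul hr hs
  rw [supported, supported, Submodule.span_mul_span] at h'
  refine Submodule.span_le.2 ?_ h'
  rintro _ ⟨_, ⟨a, ha, rfl⟩, _, ⟨b, hb, rfl⟩, rfl⟩
  simp only [monomial_mul_monomial]
  exact Submodule.smul_mem _ _ (monomial_mem_supported (h a ha b hb))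

theorem mem_supported_univ (r : SkewPoly q) : r ∈ supported q Set.univ := by
  rw [supported, Set.image_univ, span_monomial]
  trivial

/-- The exponents of the monomials divisible by some monomial with exponent in `S`. -/
def multiples (S : Set (Fin n → ℕ)) : Set (Fin n → ℕ) := {a | ∃ s ∈ S, s ≤ a}

/-- The ideal of elements whose monomials are multiples of monomials with exponents in `S`. -/
noncomputable def monomialIdeal (q : Fin n → Fin n → kˣ) (S : Set (Fin n → ℕ)) :
    TwoSidedIdeal (SkewPoly q) :=
  TwoSidedIdeal.mk' (supported q (multiples S)) (Submodule.zero_mem _)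
    (fun hx hy => Submodule.add_mem _ hx hy) (fun hx => Submodule.neg_mem _ hx)
    (fun {x _} hy => mul_mem_supported (U := Set.univ) (V := multiples S)
      (W := multiples S)
      (fun _ _ _ ⟨s, hs, hle⟩ => ⟨s, hs, le_add_left hle⟩) (mem_supported_univ x) hy)
    (fun {_ y} hx => mul_mem_supported (U := multiples S) (V := Set.univ)
      (W := multiples S)
      (fun _ ⟨s, hs, hle⟩ _ _ => ⟨s, hs, le_add_right hle⟩) hx (mem_supported_univ y))

theorem mem_monomialIdeal {S : Set (Fin n → ℕ)} {r : SkewPoly q} :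
    r ∈ monomialIdeal q S ↔ r ∈ supported q (multiples S) :=
  TwoSidedIdeal.mem_mk' _ _ _ _ _ _ _

theorem smul_mem_twoSidedIdeal (I : TwoSidedIdeal (SkewPoly q)) (c : k) {r : SkewPoly q}
    (hr : r ∈ I) : c • r ∈ I := by
  rw [← smul_one_mul]
  exact I.mul_mem_left _ _ hr

theorem span_monomial_eq_monomialIdeal (S : Set (Fin n → ℕ)) :
    TwoSidedIdeal.span (monomial q '' S) = monomialIdeal q S := by
  refine le_antisymm ?_ ?_
  · rw [TwoSidedIdeal.span_le]
    rintro _ ⟨a, ha, rfl⟩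
    exact mem_monomialIdeal.2 (monomial_mem_supported ⟨a, ha, le_rfl⟩)
  · intro r hr
    rw [mem_monomialIdeal, supported] at hr
    induction hr using Submodule.closure_induction with
    | zero => exact TwoSidedIdeal.zero_mem _
    | add x y _ _ hx hy => exact TwoSidedIdeal.add_mem _ hx hy
    | smul_mem c x hx =>
      obtain ⟨a, ⟨s, hs, hle⟩, rfl⟩ := hx
      obtain ⟨b, rfl⟩ := exists_add_of_le hle
      rw [monomial_add]
      refine smul_mem_twoSidedIdeal _ _ (smul_mem_twoSidedIdeal _ _ ?_)
      exact TwoSidedIdeal.mul_mem_right _ _ _ (TwoSidedIdeal.subset_span ⟨s, hs, rfl⟩)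

theorem mem_irrelevantIdeal (hq : IsSkewParameter q) {r : SkewPoly q} :
    r ∈ irrelevantIdeal q ↔ coeff hq 0 r = 0 := by
  have h : Set.range (var q) = monomial q '' Set.range (fun i => Pi.single i 1) := by
    rw [← Set.range_comp]
    congr 1
    funext i
    exact (monomial_single i).symm
  rw [irrelevantIdeal, h, span_monomial_eq_monomialIdeal, mem_monomialIdeal, mem_supported hq]
  constructor
  · intro h
    by_contra hne
    obtain ⟨_, ⟨i, rfl⟩, hle⟩ := h 0 hne
    simpa using hle i
  · intro h a ha
    have hne : a ≠ 0 := by rintro rfl; exact ha h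
    obtain ⟨i, hi⟩ := Function.ne_iff.1 hne
    refine ⟨_, ⟨i, rfl⟩, fun j => ?_⟩
    by_cases hj : j = i
    · subst hj; simpa using Nat.one_le_iff_ne_zero.2 hi
    · simp [hj]

theorem mem_irrelevantIdeal_iff_supported (hq : IsSkewParameter q) {r : SkewPoly q} :
    r ∈ irrelevantIdeal q ↔ r ∈ supported q {0}ᶜ := by
  rw [mem_irrelevantIdeal hq, mem_supported hq]
  constructor
  · rintro h a ha rfl
    exact ha h
  · intro h
    by_contra hne
    exact h 0 hne rfl

theorem coeff_zero_one (hq : IsSkewParameter q) : coeff hq 0 (1 : SkewPoly q) = 1 := by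
  rw [← monomial_zero, coeff_monomial, if_pos rfl]

/-- A product of two elements of `(x_1, …, x_n)` has no linear terms. -/
theorem coeff_single_mul_eq_zero (hq : IsSkewParameter q) {r s : SkewPoly q}
    (hr : r ∈ irrelevantIdeal q) (hs : s ∈ irrelevantIdeal q) (j : Fin n) :
    coeff hq (Pi.single j 1) (r * s) = 0 := by
  rw [mem_irrelevantIdeal_iff_supported hq] at hr hs
  by_contra hne
  have h := (mem_supported hq).1 (mul_mem_supported (W := {a | 2 ≤ ∑ i, a i}) ?_ hr hs) _ hne
  · simp at h
  · intro a ha b hb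
    have h1 : ∀ a : Fin n → ℕ, a ∈ ({0}ᶜ : Set (Fin n → ℕ)) → 1 ≤ ∑ i, a i := by
      intro a ha
      rw [Nat.one_le_iff_ne_zero]
      intro h0
      exact ha (funext fun i => (Finset.sum_eq_zero_iff.1 h0) i (Finset.mem_univ i))
    have := h1 a ha
    have := h1 b hb
    simp only [Set.mem_ofPred_eq, Pi.add_apply, Finset.sum_add_distrib]
    omega

theorem coeff_single_var_mul (hq : IsSkewParameter q) (i j : Fin n) (r : SkewPoly q)
    (h : i ≠ j) : coeff hq (Pi.single j 1) (var q i * r) = 0 := by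
  rw [← monomial_single]
  refine coeff_monomial_mul_of_not_le hq (fun hle => ?_) r
  have := hle i
  simp [h] at this

theorem coeff_single_var_mul_self (hq : IsSkewParameter q) (j : Fin n) (r : SkewPoly q) :
    coeff hq (Pi.single j 1) (var q j * r) = 0 ↔ r ∈ irrelevantIdeal q := by
  have h := coeff_add_monomial_mul hq (Pi.single j 1) 0 r
  rw [add_zero, monomial_single] at h
  rw [h, mem_irrelevantIdeal hq, Units.mul_right_eq_zero]

end Ring

/-! ### Enumeration of the generators of a syzygy module. -/

/-- The pairs index generators: `β` is the leading position, `γ` the variable leading there. The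
last clause is the hockey-stick identity summed over positions; it drives the recursion for the
Betti numbers. -/
theorem exists_lex_enumeration (n : ℕ) {r : ℕ} (m : Fin r → ℕ) (hm : ∀ b, m b ≤ n) :
    ∃ (s : ℕ) (β : Fin s → Fin r) (γ : Fin s → Fin n),
      (∀ b (j : Fin n), (j : ℕ) < m b → ∃ c, β c = b ∧ γ c = j) ∧
      (∀ c, (γ c : ℕ) < m (β c)) ∧
      (∀ c d, c < d ↔ β c < β d ∨ β c = β d ∧ γ c < γ d) ∧
      ∀ p, ∑ c, ((γ c : ℕ).choose p) = ∑ b, (m b).choose (p + 1) := by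
  classical
  let S : Finset (Fin r ×ₗ Fin n) := Finset.univ.filter fun x => ((ofLex x).2 : ℕ) < m (ofLex x).1
  let e : Fin S.card ≃o S := S.orderIsoOfFin rfl
  have hS : ∀ c, ((ofLex (e c).1).2 : ℕ) < m (ofLex (e c).1).1 := fun c => by
    have := (e c).2
    simpa only [S, Finset.mem_filter, Finset.mem_univ, true_and] using this
  refine ⟨S.card, fun c => (ofLex (e c).1).1, fun c => (ofLex (e c).1).2, ?_, hS, ?_, ?_⟩
  · intro b j hj
    refine ⟨e.symm ⟨toLex (b, j), by simpa [S] using hj⟩, ?_, ?_⟩ <;> simp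
  · intro c d
    rw [← e.lt_iff_lt, ← Subtype.coe_lt_coe, Prod.Lex.lt_iff]
  · intro p
    refine (Equiv.sum_comp e.toEquiv (fun x : S => ((ofLex x.1).2 : ℕ).choose p)).trans ?_
    rw [Finset.sum_coe_sort S (fun x => ((ofLex x).2 : ℕ).choose p), Finset.sum_filter,
      ← Equiv.sum_comp (toLex : Fin r × Fin n ≃ Fin r ×ₗ Fin n), Fintype.sum_prod_type]
    refine Finset.sum_congr rfl fun b _ => ?_
    change ∑ y : Fin n, (if (y : ℕ) < m b then (y : ℕ).choose p else 0) = _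
    rw [Fin.sum_univ_eq_sum_range (fun i => if i < m b then i.choose p else 0) n,
      ← Finset.sum_filter]
    have : (Finset.range n).filter (fun i => i < m b) = Finset.range (m b) := by
      ext i
      have := hm b
      simp only [Finset.mem_filter, Finset.mem_range]
      omega
    rw [this]
    induction m b with
    | zero => simp
    | succ l ih => rw [Finset.sum_range_succ, ih, Nat.choose_succ_succ', add_comm]

/-! ### Linear maps out of free right modules. -/

section RightModules

variable {R : Type*} [Ring R] {M : Type*} [AddCommGroup M] [Module Rᵐᵒᵖ M]

/-- The right linear map `v ↦ ∑ c, h_c v_c`. -/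
def rightCombination {s : ℕ} (h : Fin s → M) : (Fin s → R) →ₗ[Rᵐᵒᵖ] M where
  toFun v := ∑ c, MulOpposite.op (v c) • h c
  map_add' v w := by simp [add_smul, Finset.sum_add_distrib]
  map_smul' a v := by simp [Finset.smul_sum, mul_smul]

theorem rightCombination_apply {s : ℕ} (h : Fin s → M) (v : Fin s → R) :
    rightCombination h v = ∑ c, MulOpposite.op (v c) • h c := rfl

theorem rightCombination_single {s : ℕ} (h : Fin s → M) (c : Fin s) (a : R) :
    rightCombination h (Pi.single c a) = MulOpposite.op a • h c := by
  rw [rightCombination_apply, Finset.sum_eq_single c]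
  · simp
  · intro d _ hd; simp [hd]
  · simp

theorem rightCombination_coord {s r : ℕ} (h : Fin s → Fin r → R) (v : Fin s → R) (b : Fin r) :
    rightCombination h v b = ∑ c, h c b * v c := by
  simp [rightCombination_apply]

theorem rightCombination_mem {s : ℕ} {h : Fin s → M} {K : Submodule Rᵐᵒᵖ M}
    (hK : ∀ c, h c ∈ K) (v : Fin s → R) : rightCombination h v ∈ K :=
  Submodule.sum_mem K (t := Finset.univ) fun c _ => K.smul_mem _ (hK c)

end RightModules

/-! ### Leading ideals of syzygy modules. -/

section Syzygies

variable {k : Type*} [CommRing k] {n : ℕ} {q : Fin n → Fin n → kˣ}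

variable (q) in
/-- The ideal `(x_1, …, x_m)`. -/
noncomputable def initialIdeal (m : ℕ) : TwoSidedIdeal (SkewPoly q) :=
  monomialIdeal q {a | ∃ j : Fin n, (j : ℕ) < m ∧ a = Pi.single j 1}

theorem mem_initialIdeal (hq : IsSkewParameter q) {m : ℕ} {r : SkewPoly q} :
    r ∈ initialIdeal q m ↔ ∀ a, coeff hq a r ≠ 0 → ∃ j : Fin n, (j : ℕ) < m ∧ a j ≠ 0 := by
  rw [initialIdeal, mem_monomialIdeal, mem_supported hq]
  refine forall₂_congr fun a _ => ⟨?_, ?_⟩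
  · rintro ⟨_, ⟨j, hj, rfl⟩, hle⟩
    refine ⟨j, hj, fun h0 => ?_⟩
    have := hle j
    simp [h0] at this
  · rintro ⟨j, hj, h0⟩
    refine ⟨_, ⟨j, hj, rfl⟩, fun i => ?_⟩
    by_cases hi : i = j
    · subst hi; simpa using Nat.one_le_iff_ne_zero.2 h0
    · simp [hi]

theorem var_mem_initialIdeal {m : ℕ} {j : Fin n} (hj : (j : ℕ) < m) :
    var q j ∈ initialIdeal q m := by
  rw [initialIdeal, mem_monomialIdeal, ← monomial_single]
  exact monomial_mem_supported ⟨_, ⟨j, hj, rfl⟩, le_rfl⟩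

theorem exists_eq_sum_var_mul {m : ℕ} {r : SkewPoly q} (hr : r ∈ initialIdeal q m) :
    ∃ s : Fin n → SkewPoly q, (∀ j : Fin n, m ≤ j → s j = 0) ∧ r = ∑ j, var q j * s j := by
  rw [initialIdeal, mem_monomialIdeal, supported] at hr
  induction hr using Submodule.closure_induction with
  | zero => exact ⟨0, by simp, by simp⟩
  | add x y _ _ hx hy =>
    obtain ⟨s, hs, rfl⟩ := hx
    obtain ⟨t, ht, rfl⟩ := hy
    refine ⟨s + t, fun j hj => by simp [hs j hj, ht j hj], ?_⟩
    simp [mul_add, Finset.sum_add_distrib]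
  | smul_mem c x hx =>
    obtain ⟨a, ⟨_, ⟨j, hj, rfl⟩, hle⟩, rfl⟩ := hx
    obtain ⟨b, rfl⟩ := exists_add_of_le hle
    refine ⟨Pi.single j (c • (((cocycle q (Pi.single j 1) b)⁻¹ : kˣ) : k) • monomial q b), ?_, ?_⟩
    · intro i hi
      have : i ≠ j := by rintro rfl; omega
      simp [this]
    · rw [Finset.sum_eq_single j]
      · rw [monomial_add, monomial_single]; simp
      · intro i _ hi; simp [hi]
      · simp

/-- A variable is regular modulo the preceding ones, since multiplying by it leaves their exponents
unchanged. -/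
theorem mem_initialIdeal_of_var_mul_mem (hq : IsSkewParameter q) {j : Fin n} {r : SkewPoly q}
    (h : var q j * r ∈ initialIdeal q j) : r ∈ initialIdeal q j := by
  rw [mem_initialIdeal hq] at h ⊢
  intro a ha
  obtain ⟨i, hi, h0⟩ := h (Pi.single j 1 + a) (by
    rw [← monomial_single, coeff_add_monomial_mul, Ne, Units.mul_right_eq_zero]
    exact ha)
  refine ⟨i, hi, ?_⟩
  have : i ≠ j := by rintro rfl; omega
  simpa [this] using h0

/-- A submodule `K` of a free right module such that, for all `b`, the leading coefficients of the
elements of `K` with leading position `b` form the ideal `(x_1, …, x_{m b})`, and such that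
all coordinates of elements of `K` lie in `(x_1, …, x_n)`. -/
structure HasVariableLeadingIdeals {r : ℕ} (m : Fin r → ℕ)
    (K : Submodule (SkewPoly q)ᵐᵒᵖ (Fin r → SkewPoly q)) : Prop where
  le : ∀ b, m b ≤ n
  exists_mem : ∀ b (j : Fin n), (j : ℕ) < m b →
    ∃ v ∈ K, v b = var q j ∧ ∀ c, b < c → v c = 0
  leading : ∀ v ∈ K, ∀ b, (∀ c, b < c → v c = 0) → v b ∈ initialIdeal q (m b)
  minimal : ∀ v ∈ K, ∀ b, v b ∈ irrelevantIdeal q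

variable {r : ℕ} {m : Fin r → ℕ} {K : Submodule (SkewPoly q)ᵐᵒᵖ (Fin r → SkewPoly q)}

/-- Division algorithm: cancel the top coordinate, then descend. The bound on the generators used is
needed when correcting a syzygy without disturbing its leading coordinate. -/
theorem HasVariableLeadingIdeals.exists_combination (hK : HasVariableLeadingIdeals m K) {s : ℕ}
    {β : Fin s → Fin r} {γ : Fin s → Fin n}
    (hex : ∀ b (j : Fin n), (j : ℕ) < m b → ∃ c, β c = b ∧ γ c = j)
    {h : Fin s → Fin r → SkewPoly q} (hmem : ∀ c, h c ∈ K)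
    (hlead : ∀ c, h c (β c) = var q (γ c)) (hzero : ∀ c b, β c < b → h c b = 0) (t : ℕ) :
    ∀ v ∈ K, (∀ b : Fin r, t ≤ b → v b = 0) →
      ∃ y : Fin s → SkewPoly q, rightCombination h y = v ∧ ∀ c, t ≤ (β c : ℕ) → y c = 0 := by
  induction t with
  | zero =>
    intro v _ hv
    refine ⟨0, ?_, by simp⟩
    rw [map_zero]
    exact (funext fun b => hv b (Nat.zero_le _)).symm
  | succ t ih =>
    intro v hvK hv
    by_cases ht : t < r
    swap
    · obtain ⟨y, hy, hy0⟩ := ih v hvK fun b hb => absurd b.2 (by omega)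
      exact ⟨y, hy, fun c _ => hy0 c (absurd (β c).2 (by omega))⟩
    obtain ⟨a, ha, hva⟩ := exists_eq_sum_var_mul (hK.leading v hvK ⟨t, ht⟩ fun c hc => hv c hc)
    choose φ hφ using hex ⟨t, ht⟩
    -- Writing the leading coordinate as `∑ x_j a_j`, this combination of generators leading at
    -- position `t` cancels it.
    let z : Fin s → SkewPoly q :=
      ∑ j : Fin n, if hj : (j : ℕ) < m ⟨t, ht⟩ then Pi.single (φ j hj) (a j) else 0
    have hz : rightCombination h z =
        ∑ j : Fin n, if hj : (j : ℕ) < m ⟨t, ht⟩ then MulOpposite.op (a j) • h (φ j hj) else 0 := by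
      simp only [z, map_sum, apply_dite (rightCombination h), rightCombination_single, map_zero]
    obtain ⟨y, hy, hy0⟩ := ih (v - rightCombination h z)
      (K.sub_mem hvK (rightCombination_mem hmem z)) (by
        intro b hb
        rw [hz, Pi.sub_apply, Finset.sum_apply]
        rcases hb.eq_or_lt with hb | hb
        · obtain rfl : b = ⟨t, ht⟩ := Fin.ext hb.symm
          rw [hva, sub_eq_zero]
          refine Finset.sum_congr rfl fun j _ => ?_
          split_ifs with hj
          · have := hlead (φ j hj)
            rw [(hφ j hj).1, (hφ j hj).2] at this
            simp [this]
          · simp [ha j (by omega)]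
        · rw [hv b hb, zero_sub, neg_eq_zero]
          refine Finset.sum_eq_zero fun j _ => ?_
          split_ifs with hj
          · rw [Pi.smul_apply, hzero, smul_zero]
            rw [(hφ j hj).1]
            exact hb
          · rfl)
    refine ⟨y + z, by rw [map_add, hy, sub_add_cancel], fun c hc => ?_⟩
    rw [Pi.add_apply, hy0 c (by omega), zero_add]
    refine (Finset.sum_apply _ _ _).trans (Finset.sum_eq_zero fun j _ => ?_)
    split_ifs with hj
    · rw [Pi.single_eq_of_ne]
      rintro rfl
      rw [(hφ j hj).1] at hc
      simp at hc
    · rfl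

/-- In the spirit of Schreyer's theorem: the leading ideals of the syzygies are those of the Koszul
relations between leading variables at a common position. -/
theorem HasVariableLeadingIdeals.exists_next (hq : IsSkewParameter q)
    (hK : HasVariableLeadingIdeals m K) :
    ∃ (s : ℕ) (m' : Fin s → ℕ)
      (ψ : (Fin s → SkewPoly q) →ₗ[(SkewPoly q)ᵐᵒᵖ] (Fin r → SkewPoly q)),
      LinearMap.range ψ = K ∧ HasVariableLeadingIdeals m' (LinearMap.ker ψ) ∧
      ∀ p, ∑ c, (m' c).choose p = ∑ b, (m b).choose (p + 1) := by
  obtain ⟨s, β, γ, hex, hlt, hord, hsum⟩ := exists_lex_enumeration n m hK.le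
  choose h hmem hlead hzero using fun c => hK.exists_mem (β c) (γ c) (hlt c)
  have hcomb := hK.exists_combination hex hmem hlead hzero
  -- As `γ c` counts from zero, the new bound selects exactly the variables strictly before the
  -- leading one.
  refine ⟨s, fun c => γ c, rightCombination h, ?_, ⟨fun c => (γ c).2.le, ?_, ?_, ?_⟩, hsum⟩
  · refine le_antisymm ?_ fun v hv => ?_
    · rintro _ ⟨v, rfl⟩
      exact rightCombination_mem hmem v
    · obtain ⟨y, hy, -⟩ := hcomb r v hv fun b hb => absurd b.2 (by omega)
      exact ⟨y, hy⟩
  · intro c i hi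
    obtain ⟨d, hd1, hd2⟩ := hex (β c) i (lt_trans hi (hlt c))
    -- The skew Koszul relation between the leading variables of `h c` and `h d`. What remains has
    -- lower leading position, so the correction `y` vanishes at `c` and beyond.
    let z : Fin s → SkewPoly q := Pi.single c (var q i) -
      Pi.single d (((q (γ c) i : kˣ) : k) • var q (γ c))
    obtain ⟨y, hy, hy0⟩ := hcomb (β c) (rightCombination h z) (rightCombination_mem hmem z) (by
      intro b hb
      have hz : rightCombination h z b = h c b * var q i -
          h d b * (((q (γ c) i : kˣ) : k) • var q (γ c)) := by
        rw [map_sub, rightCombination_single, rightCombination_single]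
        simp
      rw [hz]
      rcases hb.eq_or_lt with hb | hb
      · obtain rfl : b = β c := Fin.ext hb.symm
        have hd := hlead d
        rw [hd1, hd2] at hd
        rw [hlead, hd, var_mul_var, mul_smul_comm, sub_self]
      · rw [hzero c b hb, hzero d b (by rw [hd1]; exact hb), zero_mul, zero_mul, sub_zero])
    have hdc : d < c := (hord d c).2 (Or.inr ⟨hd1, by rw [hd2]; exact hi⟩)
    refine ⟨z - y, ?_, ?_, ?_⟩
    · rw [LinearMap.mem_ker, map_sub, hy, sub_self]
    · simp [z, hdc.ne', hy0 c le_rfl]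
    · intro e he
      have hbe : (β c : ℕ) ≤ β e := by
        rcases (hord c e).1 he with h | h
        · exact le_of_lt h
        · exact le_of_eq (congrArg _ h.1)
      simp [z, he.ne', (hdc.trans he).ne', hy0 e hbe]
  · intro v hv c hc
    -- In coordinate `β c` of the relation, earlier generators contribute only multiples of
    -- variables before `γ c`, and later coefficients vanish.
    apply mem_initialIdeal_of_var_mul_mem hq
    have h0 : ∑ e, h e (β c) * v e = 0 := by
      rw [← rightCombination_coord, LinearMap.mem_ker.1 hv, Pi.zero_apply]
    rw [← Finset.add_sum_erase _ _ (Finset.mem_univ c), hlead] at h0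
    rw [eq_neg_of_add_eq_zero_left h0]
    refine TwoSidedIdeal.neg_mem _ (TwoSidedIdeal.finsetSum_mem _ _ _ fun e he => ?_)
    have hne := (Finset.mem_erase.1 he).1
    rcases hne.lt_or_gt with hlt' | hgt
    · rcases (hord e c).1 hlt' with h1 | ⟨h1, h2⟩
      · rw [hzero e _ h1, zero_mul]
        exact TwoSidedIdeal.zero_mem _
      · rw [← h1, hlead]
        exact TwoSidedIdeal.mul_mem_right _ _ _ (var_mem_initialIdeal h2)
    · rw [hc e hgt, mul_zero]
      exact TwoSidedIdeal.zero_mem _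
  · intro v hv
    -- Descending induction on `β c`, comparing coefficients of the variable `γ c` in coordinate `β
    -- c`. Lower positions contribute zero, equal positions other variables, and higher positions
    -- products of two elements without constant term.
    have key : ∀ t : ℕ, ∀ c, r ≤ (β c : ℕ) + t → v c ∈ irrelevantIdeal q := by
      intro t
      induction t with
      | zero => intro c hc; exact absurd (β c).2 (by omega)
      | succ t ih =>
        intro c hc
        rw [← coeff_single_var_mul_self hq (γ c), ← hlead]
        have h0 : ∑ e, coeff hq (Pi.single (γ c) 1) (h e (β c) * v e) = 0 := by
          rw [← map_sum, ← rightCombination_coord, LinearMap.mem_ker.1 hv, Pi.zero_apply, map_zero]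
        rw [← h0, eq_comm]
        refine Finset.sum_eq_single_of_mem c (Finset.mem_univ c) fun e _ he => ?_
        rcases lt_trichotomy (β e) (β c) with h1 | h1 | h1
        · rw [hzero e _ h1, zero_mul, map_zero]
        · rw [← h1, hlead]
          refine coeff_single_var_mul hq _ _ _ fun h2 => ?_
          rcases he.lt_or_gt with h3 | h3
          · have := (hord e c).1 h3
            simp [h1, h2] at this
          · have := (hord c e).1 h3
            simp [h1, h2] at this
        · exact coeff_single_mul_eq_zero hq (hK.minimal _ (hmem e) _) (ih e (by
            have : (β c : ℕ) < β e := h1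
            omega)) _
    exact fun c => key r c (by omega)

end Syzygies

/-! ### The largest index of a variable in a monomial. -/

section Combinatorics

variable {n : ℕ}

theorem maxIdx_le_add_iff (a : Fin n → ℕ) (t : ℕ) :
    maxIdx a ≤ t + 1 ↔ ∀ i, 0 < a i → (i : ℕ) ≤ t := by
  simp [maxIdx]

theorem one_le_maxIdx (a : Fin n → ℕ) : 1 ≤ maxIdx a := le_max_left _ _

theorem lt_maxIdx {a : Fin n → ℕ} {i : Fin n} (h : 0 < a i) : (i : ℕ) < maxIdx a := by
  have h1 := one_le_maxIdx a
  have := (maxIdx_le_add_iff a (maxIdx a - 1)).1 (by omega) i h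
  omega

theorem exists_maxIdx_eq {a : Fin n → ℕ} (h : a ≠ 0) :
    ∃ i, 0 < a i ∧ (i : ℕ) + 1 = maxIdx a := by
  obtain ⟨j, hj⟩ := Function.ne_iff.1 h
  have hj : 0 < a j := Nat.pos_of_ne_zero hj
  by_contra! hne
  have h1 := lt_maxIdx hj
  by_cases h0 : maxIdx a = 1
  · exact hne j hj (by omega)
  · have := (maxIdx_le_add_iff a (maxIdx a - 2)).2 fun i hi => by
      have := hne i hi
      have := lt_maxIdx hi
      omega
    omega

theorem maxIdx_le (a : Fin n → ℕ) : maxIdx a - 1 ≤ n := by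
  by_cases h : a = 0
  · have := (maxIdx_le_add_iff a 0).2 (by simp [h])
    omega
  · obtain ⟨i, -, hi⟩ := exists_maxIdx_eq h
    omega

end Combinatorics

/-! ### Decomposition in stable ideals and linear quotients. -/

section Stable

variable {k : Type*} [CommRing k] {n : ℕ} {q : Fin n → Fin n → kˣ}

theorem mem_canonicalGenerators {I : TwoSidedIdeal (SkewPoly q)} {u : Fin n → ℕ} :
    u ∈ canonicalGenerators I ↔ Minimal (fun b => monomial q b ∈ I) u := by
  simp [canonicalGenerators, minimalMonomials]

theorem monomial_mem_of_le {I : TwoSidedIdeal (SkewPoly q)} {a b : Fin n → ℕ}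
    (ha : monomial q a ∈ I) (h : a ≤ b) : monomial q b ∈ I := by
  obtain ⟨c, rfl⟩ := exists_add_of_le h
  rw [monomial_add]
  exact smul_mem_twoSidedIdeal _ _ (TwoSidedIdeal.mul_mem_right _ _ _ ha)

theorem exists_minimal_le {I : TwoSidedIdeal (SkewPoly q)} {w : Fin n → ℕ}
    (hw : monomial q w ∈ I) : ∃ u ∈ canonicalGenerators I, u ≤ w := by
  obtain ⟨u, hu, hm⟩ := exists_minimal_le_of_wellFoundedLT (fun b => monomial q b ∈ I) w hw
  exact ⟨u, mem_canonicalGenerators.2 hm, hu⟩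

theorem mem_iff_of_isMonomialIdeal [Nontrivial k] (hq : IsSkewParameter q)
    {I : TwoSidedIdeal (SkewPoly q)} (hI : IsMonomialIdeal I) {r : SkewPoly q} :
    r ∈ I ↔ ∀ a, coeff hq a r ≠ 0 → monomial q a ∈ I := by
  obtain ⟨S, rfl⟩ := hI
  simp_rw [span_monomial_eq_monomialIdeal, mem_monomialIdeal, monomial_mem_supported_iff hq]
  exact mem_supported hq

theorem eq_of_mem_canonicalGenerators_of_le {I : TwoSidedIdeal (SkewPoly q)} {u v : Fin n → ℕ}
    (hu : u ∈ canonicalGenerators I) (hv : v ∈ canonicalGenerators I) (h : v ≤ u) : v = u :=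
  le_antisymm h ((mem_canonicalGenerators.1 hu).2 (mem_canonicalGenerators.1 hv).1 h)

/-- Every monomial `w` of a stable ideal is a product of a generator `u` and a monomial all of
whose variables have index at least `max(u)`. -/
theorem IsStable.exists_decomposition {I : TwoSidedIdeal (SkewPoly q)} (hI : IsStable I)
    {w : Fin n → ℕ} (hw : monomial q w ∈ I) :
    ∃ u ∈ canonicalGenerators I, u ≤ w ∧ ∀ i, u i < w i → ∀ l, 0 < u l → l ≤ i := by
  induction hd : ∑ i, w i using Nat.strong_induction_on generalizing w with
  | _ d ih =>
  obtain ⟨u₀, hu₀, hle₀⟩ := exists_minimal_le hw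
  by_cases hne : u₀ = w
  · subst hne
    exact ⟨u₀, hu₀, le_rfl, fun i hi => absurd hi (lt_irrefl _)⟩
  obtain ⟨i, hi⟩ : ∃ i, u₀ i < w i := by
    by_contra! h
    exact hne (le_antisymm hle₀ h)
  obtain ⟨m, hm0, hm⟩ := exists_maxIdx_eq (a := w) fun h => by simp [h] at hi
  have hwi : monomial q (w - Pi.single i 1) ∈ I := by
    refine monomial_mem_of_le (mem_canonicalGenerators.1 hu₀).1 fun j => ?_
    by_cases hj : j = i
    · subst hj; simp; omega
    · simpa [hj] using hle₀ j
  -- If `i < m`, then `w / x_i` still has largest variable `x_m`, and the stable exchange turns it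
  -- into `w / x_m`.
  have hwm : monomial q (w - Pi.single m 1) ∈ I := by
    have him : (i : ℕ) < maxIdx w := lt_maxIdx (by omega)
    rcases (show i ≤ m by rw [Fin.le_def]; omega).eq_or_lt with rfl | him
    · exact hwi
    · have hpos : 0 < (w - Pi.single i 1 : Fin n → ℕ) m := by simpa [him.ne'] using hm0
      have hmax : (m : ℕ) + 1 = maxIdx (w - Pi.single i 1) := by
        refine le_antisymm (lt_maxIdx hpos) ((maxIdx_le_add_iff _ _).2 fun j hj => ?_)
        have := lt_maxIdx (a := w) (i := j) (lt_of_lt_of_le hj (by simp))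
        omega
      have := hI.2 _ hwi i m him hmax
      convert this using 2
      funext j
      by_cases hj : j = i
      · subst hj; simp [him.ne]; omega
      · simp [hj]
  have hlt : ∑ j, (w - Pi.single m 1 : Fin n → ℕ) j < d := by
    rw [← hd]
    refine Finset.sum_lt_sum (fun j _ => by simp) ⟨m, Finset.mem_univ m, ?_⟩
    simp; omega
  obtain ⟨u, hu, hle, hdec⟩ := ih _ hlt hwm rfl
  refine ⟨u, hu, hle.trans (by intro j; simp), fun j hj l hl => ?_⟩
  -- Restoring `x_m` preserves the condition on the cofactor, because `m` is the largest index in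
  -- `w`, hence bounds those in `u`.
  by_cases hjm : j = m
  · subst hjm
    have := lt_maxIdx (a := w) (i := l) (lt_of_lt_of_le hl ((hle l).trans (by simp)))
    rw [Fin.le_def]; omega
  · exact hdec j (by simpa [hjm] using hj) l hl

/-- If a generator `v` divides `u y`, where all variables of `y` have index at least `max(u)`,
then `v = u` or `v` is lexicographically smaller than `u`. -/
theorem toLex_le_of_le {I : TwoSidedIdeal (SkewPoly q)} {u v w : Fin n → ℕ}
    (hu : u ∈ canonicalGenerators I) (hv : v ∈ canonicalGenerators I)
    (huw : ∀ i, u i < w i → ∀ l, 0 < u l → l ≤ i) (hvw : v ≤ w) : toLex v ≤ toLex u := by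
  by_contra! hlt
  obtain ⟨i, heq, hi⟩ := hlt
  simp only [Pi.toLex_apply] at heq hi
  -- At the first difference `i`, `u i < v i ≤ w i`, so `x_i` divides the cofactor and `u` has no
  -- variable beyond `i`. Hence `u` divides `v`.
  have := eq_of_mem_canonicalGenerators_of_le hv hu fun l => ?_
  · exact absurd hi (by rw [this]; exact lt_irrefl _)
  · rcases lt_trichotomy l i with h | rfl | h
    · exact (heq l h).le
    · exact hi.le
    · by_contra! hl
      exact absurd (huw i (lt_of_lt_of_le hi (hvw i)) l ((Nat.zero_le _).trans_lt hl)) (not_le.2 h)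

/-- For a generator `u` of a stable ideal and `j < max(u)` the monomial `x_j u` is a multiple of a
lexicographically larger generator. -/
theorem IsStable.exists_toLex_lt {I : TwoSidedIdeal (SkewPoly q)} (hI : IsStable I)
    {u : Fin n → ℕ} (hu : u ∈ canonicalGenerators I) {j : Fin n}
    (hj : (j : ℕ) < maxIdx u - 1) :
    ∃ v ∈ canonicalGenerators I, v ≤ u + Pi.single j 1 ∧ toLex u < toLex v := by
  obtain ⟨m, hm0, hm⟩ := exists_maxIdx_eq (a := u) (by
    rintro rfl
    have := (maxIdx_le_add_iff (0 : Fin n → ℕ) 0).2 (by simp)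
    omega)
  obtain ⟨v, hv, hle, hdec⟩ := hI.exists_decomposition
    (monomial_mem_of_le (mem_canonicalGenerators.1 hu).1 (le_add_right le_rfl :
      u ≤ u + Pi.single j 1))
  refine ⟨v, hv, hle, ?_⟩
  have hjm : j < m := by rw [Fin.lt_def]; omega
  have hvu : v ≠ u := by
    rintro rfl
    exact absurd (hdec j (by simp) m hm0) (not_le.2 hjm)
  have hvj : u j < v j := by
    by_contra! h
    refine hvu (eq_of_mem_canonicalGenerators_of_le hu hv fun i => ?_)
    by_cases hi : i = j
    · subst hi; exact h
    · simpa [hi] using hle i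
  refine ⟨j, fun i hi => ?_, hvj⟩
  simp only [Pi.toLex_apply]
  have h1 := hle i
  simp only [Pi.add_apply, Pi.single_eq_of_ne hi.ne, add_zero] at h1
  refine le_antisymm ?_ h1
  -- Otherwise `x_i` with `i < j` divides the cofactor of `v`, although `x_j` divides `v`.
  by_contra! h
  exact absurd (hdec i (by simpa [hi.ne] using h) j (by omega)) (not_le.2 hi)

theorem monomial_mem_of_mem_canonicalGenerators {I : TwoSidedIdeal (SkewPoly q)}
    {u : Fin n → ℕ} (hu : u ∈ canonicalGenerators I) : monomial q u ∈ I :=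
  (mem_canonicalGenerators.1 hu).1

theorem exists_rightCombination_eq [Nontrivial k] (hq : IsSkewParameter q)
    {I : TwoSidedIdeal (SkewPoly q)}
    (hI : IsMonomialIdeal I) {s : ℕ} (u : Fin s → Fin n → ℕ)
    (hu : ∀ c, monomial q (u c) ∈ I)
    (hG : ∀ w ∈ canonicalGenerators I, ∃ c, u c = w) (x : I) :
    ∃ v : Fin s → SkewPoly q,
      rightCombination (fun c => (⟨monomial q (u c), hu c⟩ : I)) v = x := by
  have hx : (x : SkewPoly q) ∈ supported q {a | monomial q a ∈ I} :=
    (mem_supported hq).2 ((mem_iff_of_isMonomialIdeal hq hI).1 x.2)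
  have key : ∀ r ∈ supported q {a | monomial q a ∈ I}, ∃ v : Fin s → SkewPoly q,
      ∑ c, monomial q (u c) * v c = r := by
    intro r hr
    induction hr using Submodule.closure_induction with
    | zero => exact ⟨0, by simp⟩
    | add x y _ _ hx hy =>
      obtain ⟨v, rfl⟩ := hx
      obtain ⟨w, rfl⟩ := hy
      exact ⟨v + w, by simp [mul_add, Finset.sum_add_distrib]⟩
    | smul_mem e x hx =>
      obtain ⟨a, ha, rfl⟩ := hx
      obtain ⟨w, hw, hle⟩ := exists_minimal_le ha
      obtain ⟨c, rfl⟩ := hG w hw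
      obtain ⟨b, rfl⟩ := exists_add_of_le hle
      refine ⟨Pi.single c (e • (((cocycle q (u c) b)⁻¹ : kˣ) : k) • monomial q b), ?_⟩
      rw [Finset.sum_eq_single c]
      · rw [monomial_add]; simp
      · intro d _ hd; simp [hd]
      · simp
  obtain ⟨v, hv⟩ := key _ hx
  refine ⟨v, Subtype.ext ?_⟩
  rw [← hv]
  exact map_sum (TwoSidedIdeal.coeAddMonoidHom I) _ _

theorem coe_rightCombination {I : TwoSidedIdeal (SkewPoly q)} {s : ℕ} (g : Fin s → I)
    (v : Fin s → SkewPoly q) :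
    (rightCombination g v : SkewPoly q) = ∑ c, (g c : SkewPoly q) * v c :=
  map_sum (TwoSidedIdeal.coeAddMonoidHom I) _ _

/-- This is the linear quotient property, phrased as the start of the syzygy recursion. -/
theorem IsStable.exists_presentation [Nontrivial k] (hq : IsSkewParameter q)
    {I : TwoSidedIdeal (SkewPoly q)} (hI : IsStable I) :
    ∃ (s : ℕ) (m : Fin s → ℕ) (φ : (Fin s → SkewPoly q) →ₗ[(SkewPoly q)ᵐᵒᵖ] I),
      Function.Surjective φ ∧ HasVariableLeadingIdeals m (LinearMap.ker φ) ∧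
      ∀ p, ∑ c, (m c).choose p = ∑ u ∈ canonicalGenerators I, (maxIdx u - 1).choose p := by
  classical
  -- The dual order lists lexicographically larger generators first, so a leading coordinate belongs
  -- to the smallest generator involved.
  let S : Finset (Lex (Fin n → ℕ))ᵒᵈ :=
    (canonicalGenerators I).map (toLex.trans OrderDual.toDual).toEmbedding
  let e : Fin S.card ≃o S := S.orderIsoOfFin rfl
  let u : Fin S.card → Fin n → ℕ := fun c => ofLex (OrderDual.ofDual (e c).1)
  have hu : ∀ c, u c ∈ canonicalGenerators I := by
    intro c
    obtain ⟨w, hw, hwe⟩ := Finset.mem_map.1 (e c).2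
    have : u c = w := by simp only [u, ← hwe]; rfl
    rwa [this]
  have hG : ∀ w ∈ canonicalGenerators I, ∃ c, u c = w := by
    intro w hw
    refine ⟨e.symm ⟨OrderDual.toDual (toLex w), Finset.mem_map.2 ⟨w, hw, rfl⟩⟩, ?_⟩
    simp [u]
  have hord : ∀ c d, c < d ↔ toLex (u d) < toLex (u c) := by
    intro c d
    rw [← e.lt_iff_lt]
    rfl
  have hinj : Function.Injective u := by
    intro c d h
    by_contra hne
    rcases lt_or_gt_of_ne hne with h1 | h1
    · exact absurd ((hord c d).1 h1) (by rw [h]; exact lt_irrefl _)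
    · exact absurd ((hord d c).1 h1) (by rw [h]; exact lt_irrefl _)
  have huI : ∀ c, monomial q (u c) ∈ I := fun c => monomial_mem_of_mem_canonicalGenerators (hu c)
  let φ : (Fin S.card → SkewPoly q) →ₗ[(SkewPoly q)ᵐᵒᵖ] I :=
    rightCombination fun c => (⟨monomial q (u c), huI c⟩ : I)
  have hφ : ∀ v, v ∈ LinearMap.ker φ ↔ ∑ c, monomial q (u c) * v c = 0 := by
    intro v
    rw [LinearMap.mem_ker, ← coe_rightCombination (fun c => (⟨monomial q (u c), huI c⟩ : I))]
    exact ⟨fun h => congrArg Subtype.val h, fun h => Subtype.ext h⟩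
  refine ⟨S.card, fun c => maxIdx (u c) - 1, φ,
    exists_rightCombination_eq hq hI.1 u huI hG, ⟨fun c => maxIdx_le _, ?_, ?_, ?_⟩, ?_⟩
  · intro b j hj
    obtain ⟨w, hw, hle, hlt⟩ := hI.exists_toLex_lt (hu b) hj
    obtain ⟨d, rfl⟩ := hG w hw
    have hdb : d < b := (hord d b).2 hlt
    obtain ⟨y, hy⟩ := exists_add_of_le hle
    -- The two units make `u_b x_j` and the multiple of `u_d` equal, not merely proportional.
    let c₁ : k := cocycle q (u b) (Pi.single j 1)
    let c₂ : k := (((cocycle q (u d) y)⁻¹ : kˣ) : k)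
    refine ⟨Pi.single b (var q j) - Pi.single d (c₁ • c₂ • monomial q y), ?_, ?_, ?_⟩
    · rw [hφ]
      have : ∀ c, monomial q (u c) * (Pi.single b (var q j) -
          Pi.single d (c₁ • c₂ • monomial q y) : Fin S.card → SkewPoly q) c =
          (Pi.single b (monomial q (u b) * var q j) : Fin S.card → SkewPoly q) c -
          (Pi.single d (monomial q (u d) * (c₁ • c₂ • monomial q y)) :
            Fin S.card → SkewPoly q) c := by
        intro c
        rw [Pi.sub_apply, mul_sub]
        congr 1
        · by_cases h : c = b
          · subst h; simp
          · simp [h]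
        · by_cases h : c = d
          · subst h; simp
          · simp [h]
      simp_rw [this]
      rw [Finset.sum_sub_distrib, Fintype.sum_pi_single', Fintype.sum_pi_single',
        ← monomial_single, monomial_mul_monomial, mul_smul_comm, mul_smul_comm, hy, monomial_add]
      exact sub_self _
    · simp [hdb.ne']
    · intro c hc
      simp [hc.ne', (hdb.trans hc).ne']
  · intro v hv b hb
    rw [mem_initialIdeal hq]
    intro a ha
    rw [hφ, ← Finset.add_sum_erase _ _ (Finset.mem_univ b)] at hv
    -- The term `u_b x^a` must cancel against a multiple of an earlier, lexicographically larger
    -- generator. This is impossible if all variables of `x^a` have index at least `max(u_b)`.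
    have hne : coeff hq (u b + a) (∑ c ∈ Finset.univ.erase b, monomial q (u c) * v c) ≠ 0 := by
      have h0 := congrArg (coeff hq (u b + a)) hv
      rw [map_add, map_zero, coeff_add_monomial_mul] at h0
      rw [eq_neg_of_add_eq_zero_right h0, neg_ne_zero, Ne, Units.mul_right_eq_zero]
      exact ha
    rw [map_sum] at hne
    obtain ⟨c, hc, hcne⟩ := Finset.exists_ne_zero_of_sum_ne_zero hne
    have hcb : c < b := by
      rcases lt_or_gt_of_ne (Finset.mem_erase.1 hc).1 with h | h
      · exact h
      · rw [hb c h, mul_zero, map_zero] at hcne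
        exact absurd rfl hcne
    have hle : u c ≤ u b + a := by
      by_contra h
      exact hcne (coeff_monomial_mul_of_not_le hq h _)
    by_contra! hcon
    refine absurd (toLex_le_of_le (hu b) (hu c) (fun i hi l hl => ?_) hle)
      (not_le.2 ((hord c b).1 hcb))
    have hai : a i ≠ 0 := by
      intro h0
      simp [h0] at hi
    have h1 : ¬(i : ℕ) < maxIdx (u b) - 1 := fun h => hai (hcon i h)
    have := lt_maxIdx hl
    rw [Fin.le_def]
    omega
  · intro v hv b
    rw [hφ] at hv
    -- Generators do not divide one another, so the coefficient of `u_b` in the relation comes only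
    -- from the constant term of `v b`.
    have h0 := congrArg (coeff hq (u b + 0)) hv
    rw [map_sum, map_zero, Finset.sum_eq_single_of_mem b (Finset.mem_univ b),
      coeff_add_monomial_mul, Units.mul_right_eq_zero] at h0
    · exact (mem_irrelevantIdeal hq).2 h0
    · intro c _ hc
      refine coeff_monomial_mul_of_not_le hq (fun h => hc (hinj ?_)) _
      exact eq_of_mem_canonicalGenerators_of_le (hu b) (hu c) (by simpa using h)
  · intro p
    refine Finset.sum_bij (fun c _ => u c) (fun c _ => hu c) (fun c _ d _ h => hinj h)
      (fun w hw => ?_) (fun _ _ => rfl)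
    obtain ⟨c, hc⟩ := hG w hw
    exact ⟨c, Finset.mem_univ c, hc⟩

end Stable

/-! ### Construction of the minimal resolution. -/

section Resolution

variable {k : Type*} [CommRing k] {n : ℕ} {q : Fin n → Fin n → kˣ}

variable (q) in
/-- A submodule of a finitely generated free right module together with data on its leading
ideals. -/
structure SyzygyModule where
  rank : ℕ
  bound : Fin rank → ℕ
  carrier : Submodule (SkewPoly q)ᵐᵒᵖ (Fin rank → SkewPoly q)
  leading : HasVariableLeadingIdeals bound carrier

theorem SyzygyModule.exists_cover (hq : IsSkewParameter q) (A : SyzygyModule q) :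
    ∃ (B : SyzygyModule q)
      (ψ : (Fin B.rank → SkewPoly q) →ₗ[(SkewPoly q)ᵐᵒᵖ] (Fin A.rank → SkewPoly q)),
      LinearMap.range ψ = A.carrier ∧ LinearMap.ker ψ = B.carrier ∧
      ∀ p, ∑ c, (B.bound c).choose p = ∑ b, (A.bound b).choose (p + 1) := by
  obtain ⟨s, m', ψ, h1, h2, h3⟩ := A.leading.exists_next hq
  exact ⟨⟨s, m', _, h2⟩, ψ, h1, rfl, h3⟩

theorem IsStable.exists_minimalFreeResolution [Nontrivial k] (hq : IsSkewParameter q)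
    {I : TwoSidedIdeal (SkewPoly q)} (hI : IsStable I) :
    ∃ F : MinimalFreeResolution I, ∀ i,
      F.rank i = ∑ u ∈ canonicalGenerators I, (maxIdx u - 1).choose i := by
  obtain ⟨s, m, φ, hφ, hm, hsum⟩ := hI.exists_presentation hq
  choose next ψ hrange hker hnext using SyzygyModule.exists_cover (q := q) hq
  let A : ℕ → SyzygyModule q := fun i => next^[i] ⟨s, m, _, hm⟩
  have hA : ∀ i, A (i + 1) = next (A i) := fun i => Function.iterate_succ_apply' _ _ _
  -- Each step raises the lower binomial index by one, so `p` must vary in the induction; `p = 0`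
  -- counts the generators.
  have hsumA : ∀ i p, ∑ c, ((A i).bound c).choose p =
      ∑ u ∈ canonicalGenerators I, (maxIdx u - 1).choose (p + i) := by
    intro i
    induction i with
    | zero => exact hsum
    | succ i ih =>
      intro p
      rw [hA, hnext, ih, add_right_comm, add_assoc]
  have hd : ∀ i, ∃ d : (Fin (A (i + 1)).rank → SkewPoly q) →ₗ[(SkewPoly q)ᵐᵒᵖ]
      (Fin (A i).rank → SkewPoly q),
      LinearMap.range d = (A i).carrier ∧ LinearMap.ker d = (A (i + 1)).carrier := by
    intro i
    rw [hA]
    exact ⟨ψ _, hrange _, hker _⟩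
  choose d hd1 hd2 using hd
  refine ⟨⟨fun i => (A i).rank, d, φ, hφ, ?_, ?_, ?_⟩, ?_⟩
  · exact LinearMap.exact_iff.2 (hd1 0).symm
  · intro i
    rw [LinearMap.exact_iff, hd1, hd2]
  · intro i v j
    refine (A i).leading.minimal (d i v) ?_ j
    rw [← hd1]
    exact ⟨v, rfl⟩
  · intro i
    simpa using hsumA i 0

end Resolution

/-! ### Schanuel's lemma and projectivity of free right modules. -/

/-- Both sides are the kernel of `p.coprod p'`, the fibre product up to sign, whose two projections
are split by the liftings. -/
theorem schanuel {S : Type*} [Ring S] {A P M A' P' : Type*} [AddCommGroup A] [Module S A]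
    [AddCommGroup P] [Module S P] [AddCommGroup M] [Module S M] [AddCommGroup A'] [Module S A']
    [AddCommGroup P'] [Module S P'] [Module.Projective S P] [Module.Projective S P']
    {i : A →ₗ[S] P} {p : P →ₗ[S] M} {i' : A' →ₗ[S] P'} {p' : P' →ₗ[S] M}
    (hi : Function.Injective i) (hp : Function.Surjective p) (hip : Function.Exact i p)
    (hi' : Function.Injective i') (hp' : Function.Surjective p') (hip' : Function.Exact i' p') :
    Nonempty ((A × P') ≃ₗ[S] (A' × P)) := by
  obtain ⟨f, hf⟩ := Module.projective_lifting_property p' p hp'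
  obtain ⟨g, hg⟩ := Module.projective_lifting_property p p' hp
  have hf' : ∀ x, p' (f x) = p x := fun x => LinearMap.congr_fun hf x
  have hg' : ∀ x, p (g x) = p' x := fun x => LinearMap.congr_fun hg x
  let e : (A × P') →ₗ[S] (P × P') :=
    (i.coprod (-g)).prod (LinearMap.snd S A P')
  let e' : (A' × P) →ₗ[S] (P × P') :=
    (LinearMap.snd S A' P).prod (i'.coprod (-f))
  have e_apply : ∀ a y, e (a, y) = (i a - g y, y) := fun a y => by simp [e, sub_eq_add_neg]
  have e'_apply : ∀ a x, e' (a, x) = (x, i' a - f x) := fun a x => by simp [e', sub_eq_add_neg]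
  have he : Function.Injective e := by
    rintro ⟨a, y⟩ ⟨b, z⟩ h
    rw [e_apply, e_apply, Prod.mk.injEq] at h
    obtain ⟨h1, rfl⟩ := h
    rw [hi (sub_left_injective h1)]
  have he' : Function.Injective e' := by
    rintro ⟨a, y⟩ ⟨b, z⟩ h
    rw [e'_apply, e'_apply, Prod.mk.injEq] at h
    obtain ⟨rfl, h1⟩ := h
    rw [hi' (sub_left_injective h1)]
  have hr : LinearMap.range e = LinearMap.ker (p.coprod p') := by
    ext ⟨x, y⟩
    rw [LinearMap.mem_range, LinearMap.mem_ker, LinearMap.coprod_apply]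
    constructor
    · rintro ⟨⟨a, z⟩, h⟩
      rw [e_apply, Prod.mk.injEq] at h
      obtain ⟨rfl, rfl⟩ := h
      simp [hg', hip.apply_apply_eq_zero]
    · intro h
      obtain ⟨a, ha⟩ := (hip (x + g y)).1 (by rw [map_add, hg', h])
      exact ⟨(a, y), by rw [e_apply, ha, add_sub_cancel_right]⟩
  have hr' : LinearMap.range e' = LinearMap.ker (p.coprod p') := by
    ext ⟨x, y⟩
    rw [LinearMap.mem_range, LinearMap.mem_ker, LinearMap.coprod_apply]
    constructor
    · rintro ⟨⟨a, z⟩, h⟩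
      rw [e'_apply, Prod.mk.injEq] at h
      obtain ⟨rfl, rfl⟩ := h
      simp [hf', hip'.apply_apply_eq_zero]
    · intro h
      obtain ⟨a, ha⟩ := (hip' (y + f x)).1 (by rw [map_add, hf', add_comm, h])
      exact ⟨(a, x), by rw [e'_apply, ha, add_sub_cancel_right]⟩
  exact ⟨(LinearEquiv.ofInjective e he).trans ((LinearEquiv.ofEq _ _ (hr.trans hr'.symm)).trans
    (LinearEquiv.ofInjective e' he').symm)⟩

instance projective_pi_mulOpposite {R ι : Type*} [Ring R] [Fintype ι] :
    Module.Projective Rᵐᵒᵖ (ι → R) :=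
  Module.Projective.of_equiv (LinearEquiv.piCongrRight (R := Rᵐᵒᵖ)
    fun _ : ι => (MulOpposite.opLinearEquiv Rᵐᵒᵖ : R ≃ₗ[Rᵐᵒᵖ] Rᵐᵒᵖ).symm)

/-! ### Uniqueness of ranks and vanishing criteria. -/

section Uniqueness

variable {k : Type*} [CommRing k] {n : ℕ} {q : Fin n → Fin n → kˣ}

theorem eq_sum_op_smul_single {R : Type*} [Ring R] {ι M : Type*} [Fintype ι] [DecidableEq ι]
    [AddCommGroup M] [Module Rᵐᵒᵖ M] (f : (ι → R) →ₗ[Rᵐᵒᵖ] M) (v : ι → R) :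
    f v = ∑ i, MulOpposite.op (v i) • f (Pi.single i 1) := by
  simp_rw [← map_smul, ← map_sum]
  congr 1
  conv_lhs => rw [← Finset.univ_sum_single v]
  refine Finset.sum_congr rfl fun i _ => ?_
  rw [← Pi.single_smul]
  simp

theorem linearMap_mem_irrelevantIdeal {ι κ : Type*} [Fintype ι]
    (f : (ι → SkewPoly q) →ₗ[(SkewPoly q)ᵐᵒᵖ] (κ → SkewPoly q)) {v : ι → SkewPoly q}
    (hv : ∀ i, v i ∈ irrelevantIdeal q) (c : κ) : f v c ∈ irrelevantIdeal q := by
  classical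
  rw [eq_sum_op_smul_single f v, Finset.sum_apply]
  exact TwoSidedIdeal.finsetSum_mem _ _ _ fun i _ => TwoSidedIdeal.mul_mem_left _ _ _ (hv i)

/-- Lift each cover through the other. Since `β ∘ α` is the identity up to `ker f`, it is the
identity on constant terms, so `α` induces an injection `k^ι → k^κ`. Over a nonzero commutative ring
this bounds the cardinality. -/
theorem card_le_of_minimal_covers [Nontrivial k] (hq : IsSkewParameter q) {ι κ : Type*}
    [Fintype ι] [Fintype κ] {M : Type*} [AddCommGroup M] [Module (SkewPoly q)ᵐᵒᵖ M]
    {f : (ι → SkewPoly q) →ₗ[(SkewPoly q)ᵐᵒᵖ] M} {g : (κ → SkewPoly q) →ₗ[(SkewPoly q)ᵐᵒᵖ] M}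
    (hf : Function.Surjective f) (hg : Function.Surjective g)
    (hf' : ∀ v, f v = 0 → ∀ i, v i ∈ irrelevantIdeal q) :
    Fintype.card ι ≤ Fintype.card κ := by
  obtain ⟨α, hα⟩ := Module.projective_lifting_property g f hg
  obtain ⟨β, hβ⟩ := Module.projective_lifting_property f g hf
  have hα' : ∀ x, g (α x) = f x := fun x => LinearMap.congr_fun hα x
  have hβ' : ∀ x, f (β x) = g x := fun x => LinearMap.congr_fun hβ x
  let T : (ι → k) →ₗ[k] (κ → k) :=
    { toFun v c := coeff hq 0 (α (fun i => algebraMap k (SkewPoly q) (v i)) c)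
      map_add' v w := by
        funext c
        have : (fun i => algebraMap k (SkewPoly q) ((v + w) i)) =
            (fun i => algebraMap k (SkewPoly q) (v i)) +
              fun i => algebraMap k (SkewPoly q) (w i) := by
          funext i; simp
        rw [this, map_add, Pi.add_apply, map_add, Pi.add_apply]
      map_smul' a v := by
        funext c
        have : (fun i => algebraMap k (SkewPoly q) ((a • v) i)) =
            MulOpposite.op (algebraMap k (SkewPoly q) a) •
              fun i => algebraMap k (SkewPoly q) (v i) := by
          funext i; simp [← Algebra.commutes a]
        rw [this, map_smul, Pi.smul_apply, MulOpposite.smul_eq_mul_unop, MulOpposite.unop_op,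
          ← Algebra.commutes, ← Algebra.smul_def, map_smul, Pi.smul_apply, RingHom.id_apply] }
  refine card_le_of_injective k T ((injective_iff_map_eq_zero T).2 fun v hv => ?_)
  have h1 : ∀ c, α (fun i => algebraMap k (SkewPoly q) (v i)) c ∈ irrelevantIdeal q :=
    fun c => (mem_irrelevantIdeal hq).2 (congrFun hv c)
  have h2 := linearMap_mem_irrelevantIdeal β h1
  have h3 := hf' (β (α fun i => algebraMap k (SkewPoly q) (v i)) -
    fun i => algebraMap k (SkewPoly q) (v i)) (by rw [map_sub, hβ', hα', sub_self])
  funext i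
  have h4 := (mem_irrelevantIdeal hq).1 (h3 i)
  rw [Pi.sub_apply, map_sub, (mem_irrelevantIdeal hq).1 (h2 i), zero_sub, neg_eq_zero,
    Algebra.algebraMap_eq_smul_one, map_smul, coeff_zero_one, smul_eq_mul, mul_one] at h4
  exact h4

/-- The inductive step for comparing resolutions. Adding the identity of `R^σ` keeps the covers
minimal, which forces `a = b`; Schanuel's lemma then relates the kernels up to a common free summand
again. -/
theorem exists_stable_equiv_of_minimal_covers [Nontrivial k] (hq : IsSkewParameter q) {a b : ℕ}
    {A Z A' Z' : Type*} [AddCommGroup A] [Module (SkewPoly q)ᵐᵒᵖ A]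
    [AddCommGroup A'] [Module (SkewPoly q)ᵐᵒᵖ A'] [AddCommGroup Z] [Module (SkewPoly q)ᵐᵒᵖ Z]
    [AddCommGroup Z'] [Module (SkewPoly q)ᵐᵒᵖ Z']
    {i : A →ₗ[(SkewPoly q)ᵐᵒᵖ] (Fin a → SkewPoly q)}
    {p : (Fin a → SkewPoly q) →ₗ[(SkewPoly q)ᵐᵒᵖ] Z}
    {i' : A' →ₗ[(SkewPoly q)ᵐᵒᵖ] (Fin b → SkewPoly q)}
    {p' : (Fin b → SkewPoly q) →ₗ[(SkewPoly q)ᵐᵒᵖ] Z'}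
    (hi : Function.Injective i) (hp : Function.Surjective p) (hip : Function.Exact i p)
    (hi' : Function.Injective i') (hp' : Function.Surjective p') (hip' : Function.Exact i' p')
    (hm : ∀ v, p v = 0 → ∀ j, v j ∈ irrelevantIdeal q)
    (hm' : ∀ v, p' v = 0 → ∀ j, v j ∈ irrelevantIdeal q)
    {σ : Type} [Fintype σ]
    (e : (Z × (σ → SkewPoly q)) ≃ₗ[(SkewPoly q)ᵐᵒᵖ] (Z' × (σ → SkewPoly q))) :
    a = b ∧ Nonempty ((A × (Fin a ⊕ σ → SkewPoly q)) ≃ₗ[(SkewPoly q)ᵐᵒᵖ]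
      (A' × (Fin a ⊕ σ → SkewPoly q))) := by
  let c := LinearEquiv.sumArrowLequivProdArrow (Fin a) σ (SkewPoly q)ᵐᵒᵖ (SkewPoly q)
  let c' := LinearEquiv.sumArrowLequivProdArrow (Fin b) σ (SkewPoly q)ᵐᵒᵖ (SkewPoly q)
  let P := e.toLinearMap ∘ₗ (p.prodMap LinearMap.id) ∘ₗ c.toLinearMap
  let P' := (p'.prodMap LinearMap.id) ∘ₗ c'.toLinearMap
  let J := c.symm.toLinearMap ∘ₗ (LinearMap.inl _ _ (σ → SkewPoly q)) ∘ₗ i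
  let J' := c'.symm.toLinearMap ∘ₗ (LinearMap.inl _ _ (σ → SkewPoly q)) ∘ₗ i'
  have hP0 : ∀ v, P v = 0 ↔ p (c v).1 = 0 ∧ (c v).2 = 0 := by
    intro v
    simp only [P, LinearMap.comp_apply, LinearEquiv.coe_coe, LinearEquiv.map_eq_zero_iff,
      LinearMap.prodMap_apply, Prod.mk_eq_zero, LinearMap.id_apply]
  have hP0' : ∀ v, P' v = 0 ↔ p' (c' v).1 = 0 ∧ (c' v).2 = 0 := by
    intro v
    simp only [P', LinearMap.comp_apply, LinearEquiv.coe_coe,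
      LinearMap.prodMap_apply, Prod.mk_eq_zero, LinearMap.id_apply]
  have hP : Function.Surjective P := by
    exact e.surjective.comp
      ((Function.Surjective.prodMap hp Function.surjective_id).comp c.surjective)
  have hP' : Function.Surjective P' := by
    exact (Function.Surjective.prodMap hp' Function.surjective_id).comp c'.surjective
  have hJ : Function.Injective J :=
    c.symm.injective.comp (LinearMap.inl_injective.comp hi)
  have hJ' : Function.Injective J' :=
    c'.symm.injective.comp (LinearMap.inl_injective.comp hi')
  have hJP : Function.Exact J P := by
    intro v
    rw [hP0, hip (c v).1]
    constructor
    · rintro ⟨⟨x, hx⟩, h⟩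
      refine ⟨x, ?_⟩
      simp only [J, LinearMap.comp_apply, LinearEquiv.coe_coe]
      rw [LinearEquiv.symm_apply_eq]
      exact Prod.ext hx h.symm
    · rintro ⟨x, rfl⟩
      simp [J]
  have hJP' : Function.Exact J' P' := by
    intro v
    rw [hP0', hip' (c' v).1]
    constructor
    · rintro ⟨⟨x, hx⟩, h⟩
      refine ⟨x, ?_⟩
      simp only [J', LinearMap.comp_apply, LinearEquiv.coe_coe]
      rw [LinearEquiv.symm_apply_eq]
      exact Prod.ext hx h.symm
    · rintro ⟨x, rfl⟩
      simp [J']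
  have hmin : ∀ v, P v = 0 → ∀ j, v j ∈ irrelevantIdeal q := by
    intro v hv j
    obtain ⟨h1, h2⟩ := (hP0 v).1 hv
    rcases j with j | j
    · exact hm _ h1 j
    · have := congrFun h2 j
      change v (Sum.inr j) = 0 at this
      rw [this]
      exact TwoSidedIdeal.zero_mem _
  have hmin' : ∀ v, P' v = 0 → ∀ j, v j ∈ irrelevantIdeal q := by
    intro v hv j
    obtain ⟨h1, h2⟩ := (hP0' v).1 hv
    rcases j with j | j
    · exact hm' _ h1 j
    · have := congrFun h2 j
      change v (Sum.inr j) = 0 at this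
      rw [this]
      exact TwoSidedIdeal.zero_mem _
  have hab : a = b := by
    have h1 := card_le_of_minimal_covers hq hP hP' hmin
    have h2 := card_le_of_minimal_covers hq hP' hP hmin'
    simp only [Fintype.card_sum, Fintype.card_fin] at h1 h2
    omega
  subst hab
  exact ⟨rfl, schanuel hJ hP hJP hJ' hP' hJP'⟩

namespace MinimalFreeResolution

variable {I : TwoSidedIdeal (SkewPoly q)} (F : MinimalFreeResolution I)

/-- The cokernel of the differential into degree `i`. -/
abbrev Coker (i : ℕ) : Type _ := (Fin (F.rank i) → SkewPoly q) ⧸ LinearMap.range (F.d i)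

/-- The map `coker d_{i+1} → R^{rank i}` induced by `d_i`. -/
noncomputable def incl (i : ℕ) :
    F.Coker (i + 1) →ₗ[(SkewPoly q)ᵐᵒᵖ] (Fin (F.rank i) → SkewPoly q) :=
  (LinearMap.range (F.d (i + 1))).liftQ (F.d i)
    (LinearMap.exact_iff.1 (F.exact_succ i)).ge

theorem incl_injective (i : ℕ) : Function.Injective (F.incl i) := by
  rw [← LinearMap.ker_eq_bot]
  exact Submodule.ker_liftQ_eq_bot _ _ _ (LinearMap.exact_iff.1 (F.exact_succ i)).le

theorem exact_incl (i : ℕ) :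
    Function.Exact (F.incl i) (Submodule.mkQ (LinearMap.range (F.d i))) := by
  rw [LinearMap.exact_iff, Submodule.ker_mkQ, incl, Submodule.range_liftQ]

theorem mem_irrelevantIdeal_of_mkQ_eq_zero (i : ℕ) (v : Fin (F.rank i) → SkewPoly q)
    (hv : Submodule.mkQ (LinearMap.range (F.d i)) v = 0) (j : Fin (F.rank i)) :
    v j ∈ irrelevantIdeal q := by
  obtain ⟨w, rfl⟩ := (Submodule.Quotient.mk_eq_zero _).1 hv
  exact F.minimal i w j

/-- The cokernel of the first differential is the resolved ideal. -/
noncomputable def cokerZeroEquiv : F.Coker 0 ≃ₗ[(SkewPoly q)ᵐᵒᵖ] I :=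
  (Submodule.quotEquivOfEq _ _ (LinearMap.exact_iff.1 F.exact_zero).symm).trans
    (F.augmentation.quotKerEquivOfSurjective F.augmentation_surjective)

theorem exists_stable_equiv [Nontrivial k] (hq : IsSkewParameter q)
    (F' : MinimalFreeResolution I) (i : ℕ) :
    ∃ (σ : Type) (_ : Fintype σ), Nonempty ((F.Coker i × (σ → SkewPoly q))
      ≃ₗ[(SkewPoly q)ᵐᵒᵖ] (F'.Coker i × (σ → SkewPoly q))) := by
  induction i with
  | zero =>
    exact ⟨Empty, inferInstance, ⟨LinearEquiv.prodCongr
      (F.cokerZeroEquiv.trans F'.cokerZeroEquiv.symm) (LinearEquiv.refl _ _)⟩⟩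
  | succ i ih =>
    obtain ⟨σ, _, ⟨e⟩⟩ := ih
    exact ⟨_, inferInstance, (exists_stable_equiv_of_minimal_covers hq (F.incl_injective i)
      (Submodule.mkQ_surjective _) (F.exact_incl i) (F'.incl_injective i)
      (Submodule.mkQ_surjective _) (F'.exact_incl i) (F.mem_irrelevantIdeal_of_mkQ_eq_zero i)
      (F'.mem_irrelevantIdeal_of_mkQ_eq_zero i) e).2⟩

theorem rank_eq [Nontrivial k] (hq : IsSkewParameter q) (F' : MinimalFreeResolution I) (i : ℕ) :
    F.rank i = F'.rank i := by
  obtain ⟨σ, _, ⟨e⟩⟩ := F.exists_stable_equiv hq F' i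
  exact (exists_stable_equiv_of_minimal_covers hq (F.incl_injective i)
      (Submodule.mkQ_surjective _) (F.exact_incl i) (F'.incl_injective i)
      (Submodule.mkQ_surjective _) (F'.exact_incl i) (F.mem_irrelevantIdeal_of_mkQ_eq_zero i)
      (F'.mem_irrelevantIdeal_of_mkQ_eq_zero i) e).1

/-- A splitting shows that a basis vector of the next term is a boundary plus a vector with
coordinates in `(x_1, …, x_n)`. By minimality the boundary has such coordinates too. -/
theorem rank_succ_eq_zero_of_projective [Nontrivial k] (hq : IsSkewParameter q) (i : ℕ)
    [Module.Projective (SkewPoly q)ᵐᵒᵖ (F.Coker i)] : F.rank (i + 1) = 0 := by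
  classical
  by_contra hne
  let l : Fin (F.rank (i + 1)) := ⟨0, Nat.pos_of_ne_zero hne⟩
  obtain ⟨s, hs⟩ := Module.projective_lifting_property
    (Submodule.mkQ (LinearMap.range (F.d i))) LinearMap.id (Submodule.mkQ_surjective _)
  let e : (Fin (F.rank i) → SkewPoly q) →ₗ[(SkewPoly q)ᵐᵒᵖ] (Fin (F.rank i) → SkewPoly q) :=
    LinearMap.id - s ∘ₗ Submodule.mkQ (LinearMap.range (F.d i))
  have he : ∀ v, ∃ w, F.d i w = e v := by
    intro v
    have : e v ∈ LinearMap.range (F.d i) := by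
      rw [← Submodule.ker_mkQ (LinearMap.range (F.d i)), LinearMap.mem_ker]
      have h := LinearMap.congr_fun hs (Submodule.mkQ (LinearMap.range (F.d i)) v)
      simp only [LinearMap.comp_apply, LinearMap.id_apply] at h
      simp only [e, LinearMap.sub_apply, LinearMap.id_apply, LinearMap.comp_apply, map_sub, h,
        sub_self]
    exact this
  have hed : ∀ w, e (F.d i w) = F.d i w := by
    intro w
    have : Submodule.mkQ (LinearMap.range (F.d i)) (F.d i w) = 0 :=
      (Submodule.Quotient.mk_eq_zero _).2 ⟨w, rfl⟩
    simp only [e, LinearMap.sub_apply, LinearMap.id_apply, LinearMap.comp_apply, this, map_zero,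
      sub_zero]
  -- The projector `e` onto the image of `d_i` factors through `d_i`; evaluating the factor at
  -- `d_i(e_l)` gives another preimage of that vector.
  choose w hw using fun t => he (Pi.single t 1)
  let x := rightCombination w (F.d i (Pi.single l 1))
  have hx : F.d i x = F.d i (Pi.single l 1) := by
    rw [← hed (Pi.single l 1), eq_sum_op_smul_single e]
    simp only [x, rightCombination_apply, map_sum, map_smul, hw]
  obtain ⟨y, hy⟩ := (F.exact_succ i (Pi.single l 1 - x)).1 (by rw [map_sub, hx, sub_self])
  have h1 := F.minimal (i + 1) y l
  have h2 : x l ∈ irrelevantIdeal q := by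
    simp only [x, rightCombination_coord]
    exact TwoSidedIdeal.finsetSum_mem _ _ _ fun t _ =>
      TwoSidedIdeal.mul_mem_left _ _ _ (F.minimal i _ t)
  rw [hy] at h1
  have h3 := TwoSidedIdeal.add_mem _ h1 h2
  rw [Pi.sub_apply, sub_add_cancel, Pi.single_eq_same, mem_irrelevantIdeal hq,
    coeff_zero_one] at h3
  exact one_ne_zero h3

theorem rank_zero_eq_zero_of_subsingleton [Nontrivial k] (hq : IsSkewParameter q)
    [Subsingleton (F.Coker 0)] : F.rank 0 = 0 := by
  by_contra hne
  let l : Fin (F.rank 0) := ⟨0, Nat.pos_of_ne_zero hne⟩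
  have h3 := F.mem_irrelevantIdeal_of_mkQ_eq_zero 0 (Pi.single l 1)
    (Subsingleton.elim _ _) l
  rw [Pi.single_eq_same, mem_irrelevantIdeal hq, coeff_zero_one] at h3
  exact one_ne_zero h3

open CategoryTheory

theorem shortExact (i : ℕ) : (ShortComplex.mk (ModuleCat.ofHom (F.incl i))
    (ModuleCat.ofHom (Submodule.mkQ (LinearMap.range (F.d i))))
    (ModuleCat.hom_ext (LinearMap.ext fun x => (F.exact_incl i).apply_apply_eq_zero x))).ShortExact where
  exact := by
    rw [ShortComplex.ShortExact.moduleCat_exact_iff_function_exact]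
    exact F.exact_incl i
  mono_f := (ModuleCat.mono_iff_injective _).2 (F.incl_injective i)
  epi_g := (ModuleCat.epi_iff_surjective _).2 (Submodule.mkQ_surjective _)

/-- Dimension shifting along the sequences `coker d_{i+1} → R^{rank i} → coker d_i`. -/
theorem hasProjectiveDimensionLT_coker_iff (i : ℕ) :
    HasProjectiveDimensionLT (ModuleCat.of (SkewPoly q)ᵐᵒᵖ (F.Coker 0)) (i + 1) ↔
      Module.Projective (SkewPoly q)ᵐᵒᵖ (F.Coker i) := by
  have key : ∀ i j l, l = i + j + 1 →
      (HasProjectiveDimensionLT (ModuleCat.of (SkewPoly q)ᵐᵒᵖ (F.Coker 0)) l ↔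
        HasProjectiveDimensionLT (ModuleCat.of (SkewPoly q)ᵐᵒᵖ (F.Coker i)) (j + 1)) := by
    intro i
    induction i with
    | zero => rintro j l rfl; rw [Nat.zero_add j]
    | succ i ih =>
      intro j l hl
      rw [ih (j + 1) l (by omega)]
      exact (F.shortExact i).hasProjectiveDimensionLT_X₃_iff j
        ((IsProjective.iff_projective
          (ModuleCat.of (SkewPoly q)ᵐᵒᵖ (Fin (F.rank i) → SkewPoly q))).1 projective_pi_mulOpposite)
  rw [key i 0 _ rfl, ← projective_iff_hasProjectiveDimensionLT_one]
  exact (IsProjective.iff_projective (ModuleCat.of (SkewPoly q)ᵐᵒᵖ (F.Coker i))).symm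

theorem hasProjectiveDimensionLT_iff_coker (i : ℕ) :
    HasProjectiveDimensionLT (ModuleCat.of (SkewPoly q)ᵐᵒᵖ I) i ↔
      HasProjectiveDimensionLT (ModuleCat.of (SkewPoly q)ᵐᵒᵖ (F.Coker 0)) i := by
  have e := F.cokerZeroEquiv.toModuleIso
  exact ⟨fun _ => hasProjectiveDimensionLT_of_iso e.symm i,
    fun _ => hasProjectiveDimensionLT_of_iso e i⟩

theorem rank_eq_zero_of_hasProjectiveDimensionLT [Nontrivial k] (hq : IsSkewParameter q) (i : ℕ)
    (h : HasProjectiveDimensionLT (ModuleCat.of (SkewPoly q)ᵐᵒᵖ I) i) : F.rank i = 0 := by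
  rw [F.hasProjectiveDimensionLT_iff_coker] at h
  cases i with
  | zero =>
    have := ModuleCat.subsingleton_of_isZero (isZero_of_hasProjectiveDimensionLT_zero
      (ModuleCat.of (SkewPoly q)ᵐᵒᵖ (F.Coker 0)))
    have : Subsingleton (F.Coker 0) := this
    exact F.rank_zero_eq_zero_of_subsingleton hq
  | succ i =>
    have := (F.hasProjectiveDimensionLT_coker_iff i).1 h
    exact F.rank_succ_eq_zero_of_projective hq i

theorem hasProjectiveDimensionLT_of_rank_eq_zero (i : ℕ) (h : F.rank i = 0) :
    HasProjectiveDimensionLT (ModuleCat.of (SkewPoly q)ᵐᵒᵖ I) i := by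
  rw [F.hasProjectiveDimensionLT_iff_coker]
  cases i with
  | zero =>
    have : IsEmpty (Fin (F.rank 0)) := by rw [h]; infer_instance
    have : Subsingleton (F.Coker 0) := (Submodule.mkQ_surjective _).subsingleton
    exact (ModuleCat.isZero_of_subsingleton
      (ModuleCat.of (SkewPoly q)ᵐᵒᵖ (F.Coker 0))).hasProjectiveDimensionLT_zero
  | succ i =>
    rw [F.hasProjectiveDimensionLT_coker_iff]
    have : IsEmpty (Fin (F.rank (i + 1))) := by rw [h]; infer_instance
    have hr : LinearMap.range (F.d i) = ⊥ := by
      rw [LinearMap.range_eq_bot]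
      refine LinearMap.ext fun v => ?_
      rw [Subsingleton.elim v 0, map_zero, map_zero]
    exact Module.Projective.of_equiv ((LinearMap.range (F.d i)).quotEquivOfEqBot hr).symm

theorem hasProjectiveDimensionLT_iff_rank_eq_zero [Nontrivial k] (hq : IsSkewParameter q)
    (i : ℕ) : HasProjectiveDimensionLT (ModuleCat.of (SkewPoly q)ᵐᵒᵖ I) i ↔ F.rank i = 0 :=
  ⟨F.rank_eq_zero_of_hasProjectiveDimensionLT hq i, F.hasProjectiveDimensionLT_of_rank_eq_zero i⟩

end MinimalFreeResolution

end Uniqueness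

/-! ### The projective dimension. -/

section ProjectiveDimension

variable {k : Type*} [CommRing k] [Nontrivial k] {n : ℕ} {q : Fin n → Fin n → kˣ}

theorem IsStable.projDim_eq (hq : IsSkewParameter q) {I : TwoSidedIdeal (SkewPoly q)}
    (hI : IsStable I) : projDim I = (canonicalGenerators I).sup
      (fun u => ((maxIdx u - 1 : ℕ) : WithBot ℕ∞)) := by
  obtain ⟨F, hF⟩ := hI.exists_minimalFreeResolution hq
  -- Both sides say that every binomial coefficient in the `i`-th rank vanishes. The case `i = 0`
  -- handles the value `⊥`.
  have hlt : ∀ i : ℕ, projDim I < i ↔ (canonicalGenerators I).sup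
      (fun u => ((maxIdx u - 1 : ℕ) : WithBot ℕ∞)) < i := by
    intro i
    rw [projDim, CategoryTheory.projectiveDimension_lt_iff,
      F.hasProjectiveDimensionLT_iff_rank_eq_zero hq, hF, Finset.sum_eq_zero_iff,
      Finset.sup_lt_iff (WithBot.bot_lt_coe _)]
    simp only [Nat.choose_eq_zero_iff]
    exact forall₂_congr fun u _ => by norm_cast
  refine le_antisymm ?_ ?_
  · rcases (canonicalGenerators I).eq_empty_or_nonempty with h | h
    · have := (hlt 0).2 (by simp [h])
      rw [h, Finset.sup_empty, le_bot_iff]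
      rwa [Nat.cast_zero, ← WithBot.coe_zero, ← bot_eq_zero', WithBot.lt_coe_bot] at this
    · obtain ⟨u, hu, hu'⟩ := Finset.exists_mem_eq_sup _ h
        (fun u => ((maxIdx u - 1 : ℕ) : WithBot ℕ∞))
      rw [hu']
      have := (hlt (maxIdx u - 1 + 1)).2 (by rw [hu']; norm_cast; omega)
      exact ENat.WithBot.lt_add_one_iff.1 (by simpa using this)
  · refine Finset.sup_le fun u hu => ?_
    by_contra! h
    rw [hlt] at h
    exact absurd (Finset.le_sup (f := fun u => ((maxIdx u - 1 : ℕ) : WithBot ℕ∞)) hu) (not_le.2 h)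

end ProjectiveDimension

/-! ### The Poincaré series. -/

section PoincareSeries

open PowerSeries in
-- A product of geometric series, one per variable in `s`, counts the monomials of degree `d` in
-- these variables.
theorem coeff_inv_one_sub_X_pow_card {ι : Type*} [DecidableEq ι] (s : Finset ι) (d : ℕ) :
    PowerSeries.coeff d (((1 - X : PowerSeries ℚ) ^ s.card)⁻¹) = ((s.finsuppAntidiag d).card : ℚ) := by
  have h : ((1 - X : PowerSeries ℚ) ^ s.card)⁻¹ = ∏ _i ∈ s, (PowerSeries.mk 1 : PowerSeries ℚ) := by
    rw [eq_comm, eq_inv_iff_mul_eq_one (by simp), Finset.prod_const, ← mul_pow,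
      mk_one_mul_one_sub_eq_one, one_pow]
  rw [h, coeff_prod]
  simp

variable {k : Type*} [CommRing k] {n : ℕ} {q : Fin n → Fin n → kˣ}

theorem finite_deg_eq (n j : ℕ) : {a : Fin n → ℕ | deg a = j}.Finite := by
  refine (Set.finite_Iic fun _ => j).subset fun a ha i => ?_
  rw [← show deg a = j from ha]
  exact Finset.single_le_sum (f := a) (fun _ _ => Nat.zero_le _) (Finset.mem_univ i)

theorem idealPart_eq_supported [Nontrivial k] (hq : IsSkewParameter q)
    {I : TwoSidedIdeal (SkewPoly q)} (hI : IsMonomialIdeal I) (j : ℕ) :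
    idealPart I j = supported q {a | monomial q a ∈ I ∧ deg a = j} := by
  ext r
  have h1 : r ∈ homogeneousPart q j ↔ r ∈ supported q {a | deg a = j} := Iff.rfl
  have h2 : r ∈ (TwoSidedIdeal.asIdeal I).restrictScalars k ↔ r ∈ I := by
    rw [Submodule.restrictScalars_mem, TwoSidedIdeal.mem_asIdeal]
  rw [idealPart, Submodule.mem_inf, h1, h2, mem_iff_of_isMonomialIdeal hq hI, mem_supported hq,
    mem_supported hq]
  exact ⟨fun h a ha => ⟨h.1 a ha, h.2 a ha⟩,
    fun h => ⟨fun a ha => (h a ha).1, fun a ha => (h a ha).2⟩⟩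

theorem supported_eq_span_range (U : Set (Fin n → ℕ)) :
    supported q U = Submodule.span k (Set.range fun a : U => monomial q a) := by
  rw [supported, Set.image_eq_range]

theorem linearIndependent_monomial_subtype (hq : IsSkewParameter q) (U : Set (Fin n → ℕ)) :
    LinearIndependent k fun a : U => monomial q a :=
  (linearIndependent_monomial hq).comp _ Subtype.val_injective

theorem free_supported (hq : IsSkewParameter q) (U : Set (Fin n → ℕ)) :
    Module.Free k (supported q U) := by
  rw [supported_eq_span_range]
  exact Module.Free.of_basis (Module.Basis.span (linearIndependent_monomial_subtype hq U))

theorem finite_supported {U : Set (Fin n → ℕ)} (hU : U.Finite) :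
    Module.Finite k (supported q U) :=
  Module.Finite.iff_fg.2 (Submodule.fg_span (hU.image _))

theorem finrank_supported [Nontrivial k] (hq : IsSkewParameter q) {U : Set (Fin n → ℕ)}
    (hU : U.Finite) : Module.finrank k (supported q U) = U.ncard := by
  have := hU.fintype
  rw [supported_eq_span_range, finrank_span_eq_card (linearIndependent_monomial_subtype hq U),
    ← Nat.card_eq_fintype_card, Nat.card_coe_set_eq]

/-- The indices of the variables that may occur in a cofactor of `u`. -/
def tailIndices (u : Fin n → ℕ) : Finset (Fin n) :=
  Finset.univ.filter fun i => maxIdx u ≤ (i : ℕ) + 1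

theorem card_tailIndices (u : Fin n → ℕ) : (tailIndices u).card = n + 1 - maxIdx u := by
  have h1 := one_le_maxIdx u
  have h2 := maxIdx_le u
  have h : (tailIndices u).map Fin.valEmbedding = Finset.Ico (maxIdx u - 1) n := by
    ext i
    simp only [tailIndices, Finset.mem_map, Finset.mem_filter, Finset.mem_univ, true_and,
      Fin.valEmbedding_apply, Finset.mem_Ico]
    constructor
    · rintro ⟨i, hi, rfl⟩
      omega
    · rintro ⟨h3, h4⟩
      exact ⟨⟨i, h4⟩, by simp only; omega, rfl⟩
  rw [← Finset.card_map, h, Nat.card_Ico]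
  omega

theorem mem_tailIndices {u : Fin n → ℕ} {i : Fin n} :
    i ∈ tailIndices u ↔ ∀ l, 0 < u l → l ≤ i := by
  simp [tailIndices, maxIdx_le_add_iff]

theorem deg_add (a b : Fin n → ℕ) : deg (a + b) = deg a + deg b :=
  Finset.sum_add_distrib

theorem mem_finsuppAntidiag_tailIndices {u : Fin n → ℕ} {d : ℕ} {y : Fin n →₀ ℕ} :
    y ∈ (tailIndices u).finsuppAntidiag d ↔ deg y = d ∧ ∀ i, y i ≠ 0 → i ∈ tailIndices u := by
  have h2 : y.support ⊆ tailIndices u ↔ ∀ i, y i ≠ 0 → i ∈ tailIndices u := by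
    simp [Finset.subset_iff]
  rw [Finset.mem_finsuppAntidiag, h2]
  refine and_congr_left fun h => ?_
  rw [deg, Finset.sum_subset (Finset.subset_univ (tailIndices u))]
  intro i _ hi
  by_contra hne
  exact hi (h i hne)

/-- The number of monomials of degree `j` in a stable ideal. -/
theorem IsStable.ncard_monomials {I : TwoSidedIdeal (SkewPoly q)} (hI : IsStable I) (j : ℕ) :
    {a | monomial q a ∈ I ∧ deg a = j}.ncard =
      ∑ u ∈ canonicalGenerators I with deg u ≤ j,
        ((tailIndices u).finsuppAntidiag (j - deg u)).card := by
  classical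
  let T : Finset (Σ _ : Fin n → ℕ, Fin n →₀ ℕ) :=
    ((canonicalGenerators I).filter fun u => deg u ≤ j).sigma
      fun u => (tailIndices u).finsuppAntidiag (j - deg u)
  have hT : ∀ u y, (⟨u, y⟩ : Σ _ : Fin n → ℕ, Fin n →₀ ℕ) ∈ T ↔
      (u ∈ canonicalGenerators I ∧ deg u ≤ j) ∧ deg y = j - deg u ∧
        ∀ i, y i ≠ 0 → i ∈ tailIndices u := by
    intro u y
    simp only [T, Finset.mem_sigma, Finset.mem_filter, mem_finsuppAntidiag_tailIndices]
  have himage : {a | monomial q a ∈ I ∧ deg a = j} =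
      (fun p : Σ _ : Fin n → ℕ, Fin n →₀ ℕ => p.1 + ⇑p.2) '' (T : Set _) := by
    ext w
    constructor
    · rintro ⟨hw, rfl⟩
      obtain ⟨u, hu, hle, hdec⟩ := hI.exists_decomposition hw
      obtain ⟨y, rfl⟩ := exists_add_of_le hle
      refine ⟨⟨u, Finsupp.equivFunOnFinite.symm y⟩, ?_, by simp⟩
      rw [Finset.mem_coe, hT, deg_add]
      refine ⟨⟨hu, Nat.le_add_right _ _⟩, by simp, fun i hi => mem_tailIndices.2 (hdec i ?_)⟩
      rw [Pi.add_apply]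
      exact Nat.lt_add_of_pos_right (Nat.pos_of_ne_zero hi)
    · rintro ⟨⟨u, y⟩, h, rfl⟩
      rw [Finset.mem_coe, hT] at h
      obtain ⟨⟨hu, hle⟩, hy, -⟩ := h
      refine ⟨monomial_mem_of_le (monomial_mem_of_mem_canonicalGenerators hu)
        (le_add_right le_rfl), ?_⟩
      rw [deg_add, hy, Nat.add_sub_cancel' hle]
  have hinj : Set.InjOn (fun p : Σ _ : Fin n → ℕ, Fin n →₀ ℕ => p.1 + ⇑p.2) (T : Set _) := by
    -- Two decompositions of one monomial bound each other's generators lexicographically, so the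
    -- generators coincide.
    have key : ∀ u y v z, (⟨u, y⟩ : Σ _ : Fin n → ℕ, Fin n →₀ ℕ) ∈ T →
        (⟨v, z⟩ : Σ _ : Fin n → ℕ, Fin n →₀ ℕ) ∈ T → u + ⇑y = v + ⇑z → toLex v ≤ toLex u := by
      intro u y v z h1 h2 h
      rw [hT] at h1 h2
      refine toLex_le_of_le (w := u + ⇑y) h1.1.1 h2.1.1 (fun i hi => ?_) (by
        rw [h]; exact le_add_right le_rfl)
      refine mem_tailIndices.1 (h1.2.2 i fun h0 => ?_)
      simp [h0] at hi
    rintro ⟨u, y⟩ h1 ⟨v, z⟩ h2 h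
    obtain rfl : u = v := toLex.injective
      (le_antisymm (key v z u y h2 h1 h.symm) (key u y v z h1 h2 h))
    obtain rfl : y = z := DFunLike.coe_injective (add_left_cancel h)
    rfl
  rw [himage, hinj.ncard_image, Set.ncard_coe_finset, Finset.card_sigma]

theorem IsStable.poincareSeries_eq [Nontrivial k] (hq : IsSkewParameter q)
    {I : TwoSidedIdeal (SkewPoly q)} (hI : IsStable I) :
    poincareSeries I = ∑ u ∈ canonicalGenerators I,
      (PowerSeries.X : PowerSeries ℚ) ^ deg u *
        ((1 - PowerSeries.X) ^ (n + 1 - maxIdx u))⁻¹ := by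
  ext j
  rw [poincareSeries, PowerSeries.coeff_mk, idealPart_eq_supported hq hI.1,
    finrank_supported hq ((finite_deg_eq n j).subset fun a ha => ha.2), hI.ncard_monomials,
    Finset.sum_filter, Nat.cast_sum, map_sum]
  refine Finset.sum_congr rfl fun u _ => ?_
  rw [PowerSeries.coeff_X_pow_mul', ← card_tailIndices, coeff_inv_one_sub_X_pow_card]
  split_ifs <;> simp

end PoincareSeries

end SkewEK

theorem mainTheorem4 {k : Type*} [CommRing k] [Nontrivial k] [IsNoetherianRing k] {n : ℕ}
    (q : Fin n → Fin n → kˣ) (hq : SkewEK.IsSkewParameter q)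
    (I : TwoSidedIdeal (SkewEK.SkewPoly q)) (hI : SkewEK.IsStable I) :
    (Nonempty (SkewEK.MinimalFreeResolution I) ∧
      ∀ (F : SkewEK.MinimalFreeResolution I) (i : ℕ),
        F.rank i = ∑ u ∈ SkewEK.canonicalGenerators I, (SkewEK.maxIdx u - 1).choose i) ∧
    SkewEK.projDim I =
      (SkewEK.canonicalGenerators I).sup
        (fun u => ((SkewEK.maxIdx u - 1 : ℕ) : WithBot ℕ∞)) ∧
    ((∀ j, Module.Free k (SkewEK.idealPart I j) ∧ Module.Finite k (SkewEK.idealPart I j)) ∧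
      SkewEK.poincareSeries I =
        ∑ u ∈ SkewEK.canonicalGenerators I,
          (PowerSeries.X : PowerSeries ℚ) ^ SkewEK.deg u *
            ((1 - PowerSeries.X) ^ (n + 1 - SkewEK.maxIdx u))⁻¹) := by
  obtain ⟨F₀, hF₀⟩ := hI.exists_minimalFreeResolution hq
  refine ⟨⟨⟨F₀⟩, fun F i => (F.rank_eq hq F₀ i).trans (hF₀ i)⟩, hI.projDim_eq hq, fun j => ?_,
    hI.poincareSeries_eq hq⟩
  rw [SkewEK.idealPart_eq_supported hq hI.1]
  exact ⟨SkewEK.free_supported hq _, SkewEK.finite_supported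
    ((SkewEK.finite_deg_eq n j).subset fun a ha => ha.2)⟩
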